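/- Let $n\ge 2$ and let $\Bbbk$ be $\mathbb R$ or $\mathbb C$. **Networks.** An element $e$ of $\overline E_n$ is a finite graph $\Gamma$ embedded in the closed unit disk, with $n$ boundary vertices on the circle, enumerated counterclockwise, and all other vertices in the open disk, together with a conductivity in $[0,\infty]$ on every edge (conductivity $0$ means deletion of the edge, $\infty$ means contraction; these are the cactus electrical networks). For finite conductivities $\omega\in[0,\infty)^{E(\Gamma)}$ let $M_R(\Gamma,\omega)=(x_{ij})$ be the response matrix, i.e. the $n\times n$ matrix which sends the boundary voltages to the currents entering the network at the boundary vertices, Kirchhoff's law holding at the interior vertices. Let $\Omega_n(\Gamma,\omega)$ be the $n\times 2n$ matrix with entry $(-1)^{i+j}x_{ij}$ in row $i$, column $2j-1$; entry $1$ in row $i$, column $2i$, and in row $i$, column $2i-2$ (for $i\ge2$); entry $(-1)^n$ in row $1$, column $2n$; and $0$ elsewhere. Let $X(e)\in \mathrm{Gr}(n-1,2n)$ be the limit of the row spaces of $\Omega_n(\Gamma,\omega)$ as the finite conductivities $\omega$ tend to the conductivities of $e$ (for finite conductivities this is just the row space). Let $e_\emptyset$ be the network without edges and without interior vertices. **Symplectic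 group.** For $1\le i\le 2n-2$ put $w_i=e_i+e_{i+2}\in\Bbbk^{2n}$ and let $V=\langle w_1,\dots,w_{2n-2}\rangle$. Let $\Lambda$ be the bilinear form on $V$ whose only nonzero values on the basis are $\Lambda(w_i,w_{i+1})=(-1)^{i+1}=-\Lambda(w_{i+1},w_i)$, $1\le i\le 2n-3$, and let $Sp(2n-2)$ be the group of linear automorphisms of $V$ preserving $\Lambda$. It acts on $\bigwedge^{n-1}V\subset\bigwedge^{n-1}\Bbbk^{2n}$. **Theorem.** 1. The vector $w_2\wedge w_4\wedge\dots\wedge w_{2n-2}$ is a highest weight vector of a subrepresentation $F\subset\bigwedge^{n-1}V$ of $Sp(2n-2)$ which is the fundamental representation corresponding to the last vertex of the Dynkin diagram of $\mathfrak{sp}_{2n-2}$; that is, $F$ is irreducible with highest weight $\varepsilon_1+\dots+\varepsilon_{n-1}$. 2. The Plücker point of $X(e_\emptyset)$ is $[w_2\wedge w_4\wedge\dots\wedge w_{2n-2}]$. 3. For every $e\in\overline E_n$ the point $X(e)$ is well defined (the limit exists and is unique), and its Plücker point in $\mathbb P\big(\bigwedge^{n-1}\Bbbk^{2n}\big)$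 lies in the projectivisation of the $Sp(2n-2)$-orbit of the highest weight vector $w_2\wedge w_4\wedge\dots\wedge w_{2n-2}$, i.e. it equals $[g\cdot(w_2\wedge w_4\wedge\dots\wedge w_{2n-2})]$ for some $g\in Sp(2n-2)$. -/

import Mathlib

open scoped ENNReal NNReal

/-! ### Planar circular graphs and (cactus) electrical networks -/

/-- A finite graph (loops and parallel edges allowed) embedded in the closed unit disk of `ℂ`,
with `n` boundary vertices on the unit circle enumerated counterclockwise and all other vertices
in the open disk. -/
structure PlanarCircularGraph (n : ℕ) where
  /-- the vertices -/
  Vert : Type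
  /-- the edges -/
  Edge : Type
  [fintypeVert : Fintype Vert]
  [fintypeEdge : Fintype Edge]
  /-- first end of an edge (the choice of direction is auxiliary) -/
  src : Edge → Vert
  /-- second end of an edge -/
  tgt : Edge → Vert
  /-- the boundary vertices, in their cyclic order -/
  bdry : Fin n → Vert
  /-- position of a vertex in the disk -/
  pos : Vert → ℂ
  pos_injective : Function.Injective pos
  /-- angular position of the boundary vertices -/
  angle : Fin n → ℝ
  angle_strictMono : StrictMono angle
  angle_lt : ∀ i j, angle j < angle i + 2 * Real.pi
  pos_bdry : ∀ i, pos (bdry i) = Complex.exp (angle i * Complex.I)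
  norm_pos_lt : ∀ v, v ∉ Set.range bdry → ‖pos v‖ < 1
  /-- the arc, parametrised by `[0, 1]`, that represents an edge -/
  arc : Edge → ℝ → ℂ
  arc_continuousOn : ∀ e, ContinuousOn (arc e) (Set.Icc 0 1)
  arc_zero : ∀ e, arc e 0 = pos (src e)
  arc_one : ∀ e, arc e 1 = pos (tgt e)
  arc_injOn : ∀ e, Set.InjOn (arc e) (Set.Ioo 0 1)
  norm_arc_lt : ∀ e, ∀ t ∈ Set.Ioo (0 : ℝ) 1, ‖arc e t‖ < 1
  arc_ne_pos : ∀ e, ∀ t ∈ Set.Ioo (0 : ℝ) 1, ∀ v, arc e t ≠ pos v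
  arc_disjoint : ∀ e e', e ≠ e' →
    Disjoint (arc e '' Set.Ioo (0 : ℝ) 1) (arc e' '' Set.Ioo (0 : ℝ) 1)

attribute [instance] PlanarCircularGraph.fintypeVert PlanarCircularGraph.fintypeEdge

/-- A point of the compactification `E̅ₙ`: a planar circular graph with conductivities in
`[0, ∞]`.  Edges of conductivity `0` are deleted, edges of conductivity `∞` are contracted
(the networks with all conductivities in `(0, ∞)` form `Eₙ`). -/
structure CactusNetwork (n : ℕ) extends PlanarCircularGraph n where
  /-- the conductivities -/
  weight : Edge → ℝ≥0∞

namespace PlanarCircularGraph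

variable {n : ℕ} (Γ : PlanarCircularGraph n)

lemma bdry_injective : Function.Injective Γ.bdry := by
  intro i j hij
  have h : Complex.exp (Γ.angle i * Complex.I) = Complex.exp (Γ.angle j * Complex.I) := by
    rw [← Γ.pos_bdry, ← Γ.pos_bdry, hij]
  obtain ⟨k, hk⟩ := Complex.exp_eq_exp_iff_exists_int.1 h
  have hk' : Γ.angle i = Γ.angle j + k * (2 * Real.pi) := by
    have := congrArg Complex.im hk
    simpa using this
  have h1 := Γ.angle_lt i j
  have h2 := Γ.angle_lt j i
  have hpi := Real.pi_pos
  have hk0 : k = 0 := by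
    have a1 : (k : ℝ) < 1 := by
      by_contra hc
      push Not at hc
      nlinarith
    have a2 : (-1 : ℝ) < k := by
      by_contra hc
      push Not at hc
      nlinarith
    have a1' : k < 1 := by exact_mod_cast a1
    have a2' : -1 < k := by exact_mod_cast a2
    omega
  apply Γ.angle_strictMono.injective
  simpa [hk0] using hk'

open Classical in
/-- The net electrical current that leaves the vertex `v` along the edges of the graph, for the
conductivities `w` and the voltages `φ` (Ohm's law on every edge). -/
noncomputable def current (w : Γ.Edge → ℝ≥0) (φ : Γ.Vert → ℝ) (v : Γ.Vert) : ℝ :=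
  ∑ e, (w e : ℝ) * ((if Γ.src e = v then φ (Γ.src e) - φ (Γ.tgt e) else 0) +
    (if Γ.tgt e = v then φ (Γ.tgt e) - φ (Γ.src e) else 0))

/-- `M` is a response matrix: whenever the voltages `φ` satisfy Kirchhoff's law at all interior
vertices, `M` sends the boundary voltages to the currents entering the network through the
boundary vertices. -/
def IsResponseMatrix (w : Γ.Edge → ℝ≥0) (M : Matrix (Fin n) (Fin n) ℝ) : Prop :=
  ∀ φ : Γ.Vert → ℝ, (∀ v, v ∉ Set.range Γ.bdry → Γ.current w φ v = 0) →
    M.mulVec (fun i => φ (Γ.bdry i)) = fun i => Γ.current w φ (Γ.bdry i)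

lemma sum_mul_current (w : Γ.Edge → ℝ≥0) (ψ φ : Γ.Vert → ℝ) :
    ∑ v, ψ v * Γ.current w φ v =
      ∑ e, (w e : ℝ) * ((ψ (Γ.src e) - ψ (Γ.tgt e)) * (φ (Γ.src e) - φ (Γ.tgt e))) := by
  classical
  simp only [current, Finset.mul_sum]
  rw [Finset.sum_comm]
  refine Finset.sum_congr rfl fun e _ => ?_
  have : ∀ v, ψ v * ((w e : ℝ) * ((if Γ.src e = v then φ (Γ.src e) - φ (Γ.tgt e) else 0) +
      (if Γ.tgt e = v then φ (Γ.tgt e) - φ (Γ.src e) else 0))) =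
      (if Γ.src e = v then ψ v * (w e * (φ (Γ.src e) - φ (Γ.tgt e))) else 0) +
      (if Γ.tgt e = v then ψ v * (w e * (φ (Γ.tgt e) - φ (Γ.src e))) else 0) := by
    intro v
    split_ifs <;> ring
  simp only [this, Finset.sum_add_distrib, Finset.sum_ite_eq, Finset.mem_univ, if_true]
  ring

lemma current_add (w : Γ.Edge → ℝ≥0) (φ ψ : Γ.Vert → ℝ) (v : Γ.Vert) :
    Γ.current w (φ + ψ) v = Γ.current w φ v + Γ.current w ψ v := by
  simp only [current, ← Finset.sum_add_distrib]
  refine Finset.sum_congr rfl fun e _ => ?_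
  simp only [Pi.add_apply]
  split_ifs <;> ring

lemma current_smul (w : Γ.Edge → ℝ≥0) (c : ℝ) (φ : Γ.Vert → ℝ) (v : Γ.Vert) :
    Γ.current w (c • φ) v = c * Γ.current w φ v := by
  simp only [current, Finset.mul_sum]
  refine Finset.sum_congr rfl fun e _ => ?_
  simp only [Pi.smul_apply, smul_eq_mul]
  split_ifs <;> ring

/-- The current as a linear function of the voltages. -/
noncomputable def currentLin (w : Γ.Edge → ℝ≥0) : (Γ.Vert → ℝ) →ₗ[ℝ] (Γ.Vert → ℝ) where
  toFun φ := Γ.current w φ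
  map_add' φ ψ := funext fun v => Γ.current_add w φ ψ v
  map_smul' c φ := funext fun v => Γ.current_smul w c φ v

lemma energy_zero (w : Γ.Edge → ℝ≥0) (ψ : Γ.Vert → ℝ)
    (h : ∑ v, ψ v * Γ.current w ψ v = 0) (e : Γ.Edge) :
    (w e : ℝ) * (ψ (Γ.src e) - ψ (Γ.tgt e)) = 0 := by
  rw [sum_mul_current] at h
  have hnn : ∀ e ∈ Finset.univ, 0 ≤ (w e : ℝ) *
      ((ψ (Γ.src e) - ψ (Γ.tgt e)) * (ψ (Γ.src e) - ψ (Γ.tgt e))) := fun e _ =>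
    mul_nonneg (w e).2 (mul_self_nonneg _)
  have := (Finset.sum_eq_zero_iff_of_nonneg hnn).1 h e (Finset.mem_univ e)
  rcases mul_eq_zero.1 this with h0 | h0
  · rw [h0, zero_mul]
  · rw [mul_self_eq_zero.1 h0, mul_zero]

lemma exists_harmonic (w : Γ.Edge → ℝ≥0) (U : Fin n → ℝ) :
    ∃ φ : Γ.Vert → ℝ, (∀ i, φ (Γ.bdry i) = U i) ∧
      ∀ v, v ∉ Set.range Γ.bdry → Γ.current w φ v = 0 := by
  classical
  let S : Submodule ℝ (Γ.Vert → ℝ) :=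
    { carrier := {ψ | ∀ i, ψ (Γ.bdry i) = 0}
      add_mem' := fun {a b} ha hb i => by simp [ha i, hb i]
      zero_mem' := fun i => rfl
      smul_mem' := fun c a ha i => by simp [ha i] }
  let En : (Γ.Vert → ℝ) →ₗ[ℝ] (Γ.Vert → ℝ) →ₗ[ℝ] ℝ :=
    LinearMap.mk₂ ℝ (fun φ ψ => ∑ v, ψ v * Γ.current w φ v)
      (fun a b c => by simp only [current_add, mul_add, Finset.sum_add_distrib])
      (fun c a b => by
        simp only [current_smul, smul_eq_mul, Finset.mul_sum]
        exact Finset.sum_congr rfl fun _ _ => by ring)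
      (fun a b c => by simp only [Pi.add_apply, add_mul, Finset.sum_add_distrib])
      (fun c a b => by
        simp only [Pi.smul_apply, smul_eq_mul, Finset.mul_sum]
        exact Finset.sum_congr rfl fun _ _ => by ring)
  have hEn : ∀ φ ψ, En φ ψ = ∑ v, ψ v * Γ.current w φ v := fun _ _ => rfl
  let A : S →ₗ[ℝ] Module.Dual ℝ S := (LinearMap.lcomp ℝ ℝ S.subtype).comp (En.comp S.subtype)
  have hA : ∀ (x ψ : S), A x ψ = En x ψ := fun _ _ => rfl
  let b0 : Γ.Vert → ℝ := Function.extend Γ.bdry U 0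
  let β : Module.Dual ℝ S := (En b0).comp S.subtype
  have hβ : β ∈ LinearMap.range A := by
    rw [← Subspace.dualCoannihilator_dualAnnihilator_eq (W := LinearMap.range A),
      Submodule.mem_dualAnnihilator]
    intro ψ hψ
    rw [Submodule.mem_dualCoannihilator] at hψ
    have h0 := hψ (A ψ) ⟨ψ, rfl⟩
    rw [hA, hEn] at h0
    have h1 := Γ.energy_zero w ψ h0
    change En b0 ψ = 0
    rw [hEn, sum_mul_current]
    refine Finset.sum_eq_zero fun e _ => ?_
    rw [← mul_assoc, h1 e, zero_mul]
  obtain ⟨x, hx⟩ := hβ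
  refine ⟨b0 - x, fun i => ?_, fun v hv => ?_⟩
  · have : (x : Γ.Vert → ℝ) (Γ.bdry i) = 0 := x.2 i
    simp [b0, Γ.bdry_injective.extend_apply, this]
  · have hs : (Pi.single v 1 : Γ.Vert → ℝ) ∈ S := fun i => by
      rw [Pi.single_apply, if_neg]
      exact fun h => hv ⟨i, h⟩
    have h2 := LinearMap.congr_fun hx ⟨_, hs⟩
    rw [hA] at h2
    change En x (Pi.single v 1) = En b0 (Pi.single v 1) at h2
    have h3 : En (b0 - x) (Pi.single v 1) = 0 := by
      rw [map_sub, LinearMap.sub_apply, h2, sub_self]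
    rw [hEn] at h3
    simpa only [Pi.single_apply, ite_mul, one_mul, zero_mul, Finset.sum_ite_eq', Finset.mem_univ,
      if_true] using h3

lemma current_eq_of_harmonic (w : Γ.Edge → ℝ≥0) (φ φ' : Γ.Vert → ℝ)
    (hb : ∀ i, φ (Γ.bdry i) = φ' (Γ.bdry i))
    (h : ∀ v, v ∉ Set.range Γ.bdry → Γ.current w φ v = 0)
    (h' : ∀ v, v ∉ Set.range Γ.bdry → Γ.current w φ' v = 0) :
    Γ.current w φ = Γ.current w φ' := by
  have hl : Γ.current w (φ - φ') = Γ.current w φ - Γ.current w φ' :=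
    map_sub (Γ.currentLin w) φ φ'
  have h0 : ∑ v, (φ - φ') v * Γ.current w (φ - φ') v = 0 := by
    refine Finset.sum_eq_zero fun v _ => ?_
    by_cases hv : v ∈ Set.range Γ.bdry
    · obtain ⟨i, rfl⟩ := hv
      simp [hb i]
    · rw [hl]
      simp [h v hv, h' v hv]
  have h1 := Γ.energy_zero w _ h0
  have h2 : Γ.current w (φ - φ') = 0 := by
    funext v
    simp only [current, Pi.zero_apply]
    refine Finset.sum_eq_zero fun e _ => ?_
    have := h1 e
    split_ifs <;> linarith
  rw [hl] at h2
  exact sub_eq_zero.1 h2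

/-- The response matrix exists and is unique. -/
lemma existsUnique_isResponseMatrix (w : Γ.Edge → ℝ≥0) :
    ∃! M : Matrix (Fin n) (Fin n) ℝ, Γ.IsResponseMatrix w M := by
  classical
  choose H hH1 hH2 using fun j : Fin n => Γ.exists_harmonic w (Pi.single j 1)
  refine ⟨Matrix.of fun i j => Γ.current w (H j) (Γ.bdry i), ?_, ?_⟩
  · intro φ hφ
    have hlin : Γ.current w (∑ j, φ (Γ.bdry j) • H j) =
        ∑ j, φ (Γ.bdry j) • Γ.current w (H j) := by
      change Γ.currentLin w _ = ∑ j, φ (Γ.bdry j) • Γ.currentLin w (H j)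
      simp [map_sum]
    have hc : Γ.current w φ = Γ.current w (∑ j, φ (Γ.bdry j) • H j) := by
      refine Γ.current_eq_of_harmonic w _ _ (fun i => ?_) hφ (fun v hv => ?_)
      · simp [hH1, Pi.single_apply]
      · rw [hlin]
        simp [hH2 _ v hv]
    funext i
    rw [hc, hlin]
    simp [Matrix.mulVec, dotProduct, mul_comm]
  · intro M hM
    ext i j
    have := congrFun (hM (H j) (hH2 j)) i
    simpa [hH1] using this

/-- The response matrix `M_R` of the network with finite conductivities `w`. -/
noncomputable def responseMatrix (w : Γ.Edge → ℝ≥0) : Matrix (Fin n) (Fin n) ℝ :=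
  (Γ.existsUnique_isResponseMatrix w).choose

end PlanarCircularGraph

/-- The graph without edges and without interior vertices; its boundary vertices are the `n`-th
roots of unity. -/
noncomputable def emptyPlanarCircularGraph (n : ℕ) : PlanarCircularGraph n where
  Vert := Fin n
  Edge := Empty
  src := Empty.elim
  tgt := Empty.elim
  bdry := id
  pos i := Complex.exp ((2 * Real.pi * (i : ℕ) / n : ℝ) * Complex.I)
  pos_injective := by
    intro i j h
    have hn : (0 : ℝ) < n := by exact_mod_cast i.pos
    obtain ⟨k, hk⟩ := Complex.exp_eq_exp_iff_exists_int.1 h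
    have hk' : 2 * Real.pi * (i : ℕ) / n = 2 * Real.pi * (j : ℕ) / n + k * (2 * Real.pi) := by
      have := congrArg Complex.im hk
      rw [Complex.add_im, Complex.im_ofReal_mul, Complex.im_ofReal_mul] at this
      simpa using this
    have hpi := Real.pi_pos
    have h2 : ((i : ℕ) : ℝ) = (j : ℕ) + k * n := by
      field_simp at hk'
      linarith
    have h3 : ((i : ℕ) : ℤ) = (j : ℕ) + k * n := by exact_mod_cast h2
    have hi := i.2
    have hj := j.2
    have hk0 : k = 0 := by
      have a1 : k < 1 := by
        by_contra hc
        push Not at hc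
        nlinarith
      have a2 : -1 < k := by
        by_contra hc
        push Not at hc
        nlinarith
      omega
    ext
    simp [hk0] at h3
    omega
  angle i := 2 * Real.pi * (i : ℕ) / n
  angle_strictMono := by
    intro i j hij
    have hn : (0 : ℝ) < n := by exact_mod_cast i.pos
    have : ((i : ℕ) : ℝ) < (j : ℕ) := by exact_mod_cast hij
    have hpi := Real.pi_pos
    change 2 * Real.pi * ((i : ℕ) : ℝ) / n < 2 * Real.pi * ((j : ℕ) : ℝ) / n
    gcongr
  angle_lt := by
    intro i j
    have hn : (0 : ℝ) < n := by exact_mod_cast i.pos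
    have hj : ((j : ℕ) : ℝ) < n := by exact_mod_cast j.2
    have hpi := Real.pi_pos
    have h1 : 2 * Real.pi * (j : ℕ) / n < 2 * Real.pi := by
      rw [div_lt_iff₀ hn]
      gcongr
    have h2 : 0 ≤ 2 * Real.pi * (i : ℕ) / n := by positivity
    linarith
  pos_bdry _ := rfl
  norm_pos_lt v hv := absurd ⟨v, rfl⟩ hv
  arc e := e.elim
  arc_continuousOn e := e.elim
  arc_zero e := e.elim
  arc_one e := e.elim
  arc_injOn e := e.elim
  norm_arc_lt e := e.elim
  arc_ne_pos e := e.elim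
  arc_disjoint e := e.elim

/-- The empty electrical network `e_∅`. -/
noncomputable def emptyNetwork (n : ℕ) : CactusNetwork n where
  toPlanarCircularGraph := emptyPlanarCircularGraph n
  weight e := Empty.elim e

/-! ### The point of the Grassmannian defined by a network -/

/-- The `n × 2n` matrix `Ω_n` attached to a response matrix `x`.  With rows and columns numbered
from `1`, the entry in row `i` and column `2j-1` is `(-1)^(i+j) x_{ij}`; the entries in the even
columns are `1` in row `i` and column `2i`, `1` in row `i` and column `2i-2` (for `i ≥ 2`),
`(-1)^n` in row `1` and column `2n`, and `0` elsewhere. -/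
noncomputable def omegaMatrix {n : ℕ} (x : Matrix (Fin n) (Fin n) ℝ) :
    Matrix (Fin n) (Fin (2 * n)) ℝ :=
  Matrix.of fun i c =>
    let j : Fin n := ⟨(c : ℕ) / 2, by omega⟩
    if (c : ℕ) % 2 = 0 then (-1) ^ ((i : ℕ) + (j : ℕ)) * x i j
    else (if (j : ℕ) = i then 1 else 0) + (if (j : ℕ) + 1 = i then 1 else 0) +
      (if (i : ℕ) = 0 ∧ (j : ℕ) + 1 = n then (-1) ^ n else 0)

/-- The row space of `Ω_n(Γ, w)` over `𝕜` (for `𝕜 = ℝ` or `ℂ`), for finite conductivities `w`. -/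
noncomputable def PlanarCircularGraph.rowSpace (𝕜 : Type*) [RCLike 𝕜] {n : ℕ}
    (Γ : PlanarCircularGraph n) (w : Γ.Edge → ℝ≥0) : Submodule 𝕜 (Fin (2 * n) → 𝕜) :=
  Submodule.span 𝕜 (Set.range fun i c => ((omegaMatrix (Γ.responseMatrix w) i c : ℝ) : 𝕜))

/-- `p` is the limit of the `d`-dimensional subspaces `f a` along `l` in the Grassmannian
`Gr(d, m)`: there are matrices with row spaces `f a` which converge to a matrix of rank `d` with
row space `p`. -/
def GrassmannianTendsto {𝕜 : Type*} [RCLike 𝕜] {m : ℕ} (d : ℕ) {α : Type*}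
    (f : α → Submodule 𝕜 (Fin m → 𝕜)) (l : Filter α) (p : Submodule 𝕜 (Fin m → 𝕜)) : Prop :=
  ∃ (F : α → Fin d → Fin m → 𝕜) (F₀ : Fin d → Fin m → 𝕜),
    (∀ᶠ a in l, Submodule.span 𝕜 (Set.range (F a)) = f a) ∧
    LinearIndependent 𝕜 F₀ ∧ Submodule.span 𝕜 (Set.range F₀) = p ∧
    Filter.Tendsto F l (nhds F₀)

/-- `p = X(e)`, the point of `Gr(n-1, 2n)` defined by `e ∈ E̅ₙ`: the limit of the row spaces of
`Ω_n(Γ, w)` as the finite conductivities `w` tend to those of `e`. -/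
def CactusNetwork.IsImage (𝕜 : Type*) [RCLike 𝕜] {n : ℕ} (e : CactusNetwork n)
    (p : Submodule 𝕜 (Fin (2 * n) → 𝕜)) : Prop :=
  GrassmannianTendsto (n - 1) (fun w : e.Edge → ℝ≥0 => e.rowSpace 𝕜 w)
    (Filter.comap (fun w i => (w i : ℝ≥0∞)) (nhds e.weight)) p

/-- The Plücker point of a `d`-dimensional subspace `p`, as a line in `⋀^d`: the image of
`⋀^d p`, which is spanned by `v₁ ∧ ⋯ ∧ v_d` for any basis `v` of `p`. -/
noncomputable def pluckerLine {𝕜 W : Type*} [Field 𝕜] [AddCommGroup W] [Module 𝕜 W] (d : ℕ)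
    (p : Submodule 𝕜 W) : Submodule 𝕜 (⋀[𝕜]^d W) :=
  LinearMap.range (exteriorPower.map d p.subtype)

/-! ### Symplectic groups and their fundamental representations -/

section Symplectic

variable {𝕜 W : Type*} [Field 𝕜] [AddCommGroup W] [Module 𝕜 W]

/-- The symplectic group of a space with a bilinear form: the linear automorphisms that preserve
the form. -/
def symplecticGroupOf (ω : LinearMap.BilinForm 𝕜 W) : Subgroup (W ≃ₗ[𝕜] W) where
  carrier := {g | ∀ x y, ω (g x) (g y) = ω x y}
  mul_mem' := fun {a b} ha hb x y => by
    rw [LinearEquiv.mul_apply, LinearEquiv.mul_apply, ha, hb]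
  one_mem' := fun _ _ => rfl
  inv_mem' := fun {a} ha x y => by
    rw [← ha, ← LinearEquiv.mul_apply, ← LinearEquiv.mul_apply, mul_inv_cancel]
    rfl

/-- The representation of the symplectic group on `⋀^d W`. -/
noncomputable def exteriorRep (ω : LinearMap.BilinForm 𝕜 W) (d : ℕ) :
    Representation 𝕜 (symplecticGroupOf ω) (⋀[𝕜]^d W) where
  toFun g := exteriorPower.map d (g : W ≃ₗ[𝕜] W).toLinearMap
  map_one' := exteriorPower.map_id
  map_mul' g h := by
    rw [Module.End.mul_eq_comp, ← exteriorPower.map_comp]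
    rfl

/-- A symplectic basis `p₁, …, p_k, q₁, …, q_k`. -/
def IsSymplecticBasis (ω : LinearMap.BilinForm 𝕜 W) {k : ℕ}
    (b : Module.Basis (Fin k ⊕ Fin k) 𝕜 W) : Prop :=
  (∀ i j, ω (b (.inl i)) (b (.inl j)) = 0) ∧ (∀ i j, ω (b (.inr i)) (b (.inr j)) = 0) ∧
  (∀ i j, ω (b (.inl i)) (b (.inr j)) = if i = j then 1 else 0) ∧
  (∀ i j, ω (b (.inr j)) (b (.inl i)) = if i = j then -1 else 0)

/-- `v` is a highest weight vector of weight `∑ i, lam i • ε_i` for the maximal torus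
`{diag(t₁, …, t_k, t₁⁻¹, …, t_k⁻¹)}` defined by the symplectic basis `b` and the Borel subgroup
that preserves the isotropic flag `⟨p₁⟩ ⊂ ⟨p₁, p₂⟩ ⊂ ⋯`: it is nonzero, it is fixed by the
unipotent radical of the Borel subgroup, and the torus acts on it by the weight.  The simple
roots are `ε₁ - ε₂, …, ε_{k-1} - ε_k, 2 ε_k`. -/
def IsHighestWeightVector {ω : LinearMap.BilinForm 𝕜 W} {M : Type*} [AddCommGroup M] [Module 𝕜 M]
    (ρ : Representation 𝕜 (symplecticGroupOf ω) M) {k : ℕ}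
    (b : Module.Basis (Fin k ⊕ Fin k) 𝕜 W) (lam : Fin k → ℤ) (v : M) : Prop :=
  v ≠ 0 ∧
  (∀ g : symplecticGroupOf ω,
    (∀ i, (g : W ≃ₗ[𝕜] W) (b (.inl i)) - b (.inl i) ∈
      Submodule.span 𝕜 ((fun j => b (.inl j)) '' Set.Iio i)) → ρ g v = v) ∧
  (∀ (g : symplecticGroupOf ω) (t : Fin k → 𝕜ˣ),
    (∀ i, (g : W ≃ₗ[𝕜] W) (b (.inl i)) = (t i : 𝕜) • b (.inl i)) →
    (∀ i, (g : W ≃ₗ[𝕜] W) (b (.inr i)) = ((t i)⁻¹ : 𝕜) • b (.inr i)) →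
    ρ g v = (∏ i, (t i : 𝕜) ^ lam i) • v)

/-- The fundamental weight `ε₁ + ⋯ + ε_j` of `𝔰𝔭_{2k}` at the vertex `j` of the Dynkin diagram
of type `C_k`; the last vertex corresponds to the long simple root. -/
def fundamentalWeight {k : ℕ} (j : Fin k) : Fin k → ℤ := fun i => if i ≤ j then 1 else 0

/-- `ρ` is the fundamental representation of the symplectic group at the vertex `j` of the Dynkin
diagram, with highest weight vector `v`: it is irreducible and `v` is a highest weight vector
whose weight is the fundamental weight at `j`. -/
def IsFundamentalRep {ω : LinearMap.BilinForm 𝕜 W} {M : Type*} [AddCommGroup M] [Module 𝕜 M]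
    (ρ : Representation 𝕜 (symplecticGroupOf ω) M) {k : ℕ} (j : Fin k) (v : M) : Prop :=
  ρ.IsIrreducible ∧ ∃ b : Module.Basis (Fin k ⊕ Fin k) 𝕜 W,
    IsSymplecticBasis ω b ∧ IsHighestWeightVector ρ b (fundamentalWeight j) v

end Symplectic

/-! ### The symplectic space `V` -/

section Space

variable (𝕜 : Type*) [Field 𝕜] (n : ℕ)

/-- The Gram matrix `Λ_{2n-2}`: above the diagonal its entries are `1, -1, 1, …`. -/
def lambdaMatrix : Matrix (Fin (2 * n - 2)) (Fin (2 * n - 2)) 𝕜 :=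
  Matrix.of fun i j =>
    if (i : ℕ) + 1 = j then (-1) ^ (i : ℕ) else if (j : ℕ) + 1 = i then -(-1) ^ (j : ℕ) else 0

/-- The symplectic form on `𝕜^{2n-2}`. -/
noncomputable def lambdaForm : LinearMap.BilinForm 𝕜 (Fin (2 * n - 2) → 𝕜) :=
  Matrix.toBilin' (lambdaMatrix 𝕜 n)

/-- The matrix `B_n` with rows `w_i = e_i + e_{i+2}`, `1 ≤ i ≤ 2n-2`. -/
def basisMatrix : Matrix (Fin (2 * n - 2)) (Fin (2 * n)) 𝕜 :=
  Matrix.of fun i c => if (c : ℕ) = i ∨ (c : ℕ) = i + 2 then 1 else 0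

/-- The identification of `𝕜^{2n-2}` with the span `V ⊂ 𝕜^{2n}` of the vectors `w_i`, given by
`c ↦ ∑ i, c_i w_i`. -/
noncomputable def embedV : (Fin (2 * n - 2) → 𝕜) →ₗ[𝕜] (Fin (2 * n) → 𝕜) :=
  (basisMatrix 𝕜 n).vecMulLinear

/-- The vector `w_2 ∧ w_4 ∧ ⋯ ∧ w_{2n-2}` of `⋀^{n-1} V`, in the coordinates of the basis `w`. -/
noncomputable def vacuumVector : ⋀[𝕜]^(n - 1) (Fin (2 * n - 2) → 𝕜) :=
  exteriorPower.ιMulti 𝕜 (n - 1) fun i : Fin (n - 1) =>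
    Pi.single (⟨2 * (i : ℕ) + 1, by omega⟩ : Fin (2 * n - 2)) (1 : 𝕜)

/-- The projectivisation, in `ℙ(⋀^{n-1} 𝕜^{2n})`, of the orbit of `w_2 ∧ ⋯ ∧ w_{2n-2}` under the
symplectic group; points of the projective space are lines. -/
def projectiveOrbit : Set (Submodule 𝕜 (⋀[𝕜]^(n - 1) (Fin (2 * n) → 𝕜))) :=
  {L | ∃ g : symplecticGroupOf (lambdaForm 𝕜 n),
    L = Submodule.span 𝕜 {exteriorPower.map (n - 1) (embedV 𝕜 n)
      (exteriorRep (lambdaForm 𝕜 n) (n - 1) g (vacuumVector 𝕜 n))}}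

end Space

/-!
The three assertions rest on two elementary facts.

*Representation theory.*  Let `p₁, …, p_k, q₁, …, q_k` be a symplectic basis of a space over `ℝ` or
`ℂ` and `v = p₁ ∧ ⋯ ∧ p_k`.  The span `F` of the orbit of `v` is irreducible: declare the basis
orthonormal; then the symplectic group is stable under adjoints
(`IsSymplecticBasis.exists_adjoint`), and the matrix entries on the exterior power are minors, so
the same holds there.  If a subrepresentation `N` of `F` contains a vector whose coordinate at `v`
does not vanish, then `N` contains `v`, because a torus element separates the weight of `v` from all
others (`IsSymplecticBasis.exists_separating`); otherwise `N` is orthogonal to the orbit of `v`,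
hence to `F ⊇ N`, and so it is zero (`IsSymplecticBasis.eq_bot_or_mem`).  Every basis of a Lagrangian
subspace is one half of a symplectic basis (`exists_isSymplecticBasis`).  Applied to
`w_2, w_4, …` this gives the highest weight vector, and applied to two Lagrangian subspaces it shows
that the Plücker lines of the Lagrangian subspaces of `V` form the projectivised orbit of
`w_2 ∧ w_4 ∧ ⋯` (`pluckerLine_mem_projectiveOrbit`).

*Networks.*  Boundary potentials `U`, up to a constant, and boundary currents `I` of total zero are
encoded by a vector of `V` (`boundaryVector`) in such a way that `Λ` becomes the canonical pairing
`∑ U'ᵢ Iᵢ - ∑ Uᵢ I'ᵢ` (`lambdaForm_boundaryVector`), and that the row space of `Ω_n` consists of the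
vectors with `I = M_R U`.  For conductivities in `[0, ∞]` the pairs `(U, I)` are parametrised by the
sources `h = U + I`: the network is driven through unit resistors (`IsEquilibrium`).  Such
equilibria exist for all conductivities (`exists_isEquilibrium`), they are isotropic by reciprocity,
and `n - 1` of them are independent modulo constants (`linearIndependent_stateVector`), so
that they span a Lagrangian subspace of `V`.  The unit resistors make the energy identity for
the difference of two equilibria with the same sources control the boundary potentials and the
boundary currents at once, and this yields continuity in the conductivities, also at `0` and `∞`
(`IsEquilibrium.tendsto_bdry`).  Hence the row spaces converge.
-/

/-! ### Symplectic bases, Plücker lines and the form `Λ` -/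

section SymplecticBases

variable {𝕜 W : Type*} [Field 𝕜] [AddCommGroup W] [Module 𝕜 W]

lemma IsSymplecticBasis.equiv_mem {ω : LinearMap.BilinForm 𝕜 W} {k : ℕ}
    {b b' : Module.Basis (Fin k ⊕ Fin k) 𝕜 W} (hb : IsSymplecticBasis ω b)
    (hb' : IsSymplecticBasis ω b') :
    b.equiv b' (Equiv.refl _) ∈ symplecticGroupOf ω := by
  intro x y
  have h : ω.compl₁₂ (b.equiv b' (Equiv.refl _)).toLinearMap
      (b.equiv b' (Equiv.refl _)).toLinearMap = ω := by
    refine b.ext fun i => b.ext fun j => ?_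
    obtain ⟨h1, h2, h3, h4⟩ := hb
    obtain ⟨h1', h2', h3', h4'⟩ := hb'
    rcases i with i | i <;> rcases j with j | j <;>
      simp [h1, h2, h3, h4, h1', h2', h3', h4']
  exact LinearMap.congr_fun₂ h x y

lemma exteriorRep_apply (ω : LinearMap.BilinForm 𝕜 W) (d : ℕ) (g : symplecticGroupOf ω) :
    exteriorRep ω d g = exteriorPower.map d (g : W ≃ₗ[𝕜] W).toLinearMap := rfl

/-- A basis of a Lagrangian subspace is one half of a symplectic basis: a dual family exists by
nondegeneracy, and a correction by half of its Gram matrix makes it isotropic. -/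
lemma exists_isSymplecticBasis [CharZero 𝕜] [FiniteDimensional 𝕜 W] {ω : LinearMap.BilinForm 𝕜 W}
    (hskew : ∀ x y, ω x y = -ω y x) (hnd : ∀ x, (∀ y, ω x y = 0) → x = 0) {k : ℕ}
    (hk : Module.finrank 𝕜 W = k + k) (c : Fin k → W) (hc : LinearIndependent 𝕜 c)
    (hiso : ∀ i j, ω (c i) (c j) = 0) :
    ∃ b : Module.Basis (Fin k ⊕ Fin k) 𝕜 W, IsSymplecticBasis ω b ∧ ∀ i, b (.inl i) = c i := by
  classical
  have hinj : Function.Injective ω :=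
    (injective_iff_map_eq_zero ω).2 fun x hx => hnd x fun y => by rw [hx]; rfl
  have hsurj : Function.Surjective ω :=
    (LinearMap.injective_iff_surjective_of_finrank_eq_finrank
      (Subspace.dual_finrank_eq (K := 𝕜) (V := W)).symm).1 hinj
  obtain ⟨T, hT⟩ := LinearMap.exists_leftInverse_of_injective (Fintype.linearCombination 𝕜 c)
    (LinearMap.ker_eq_bot.2 (linearIndependent_iff_injective_fintypeLinearCombination.1 hc))
  have hTc : ∀ i, T (c i) = Pi.single i 1 := fun i => by
    have := LinearMap.congr_fun hT (Pi.single i 1)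
    simpa [Fintype.linearCombination_apply_single] using this
  choose d hd using fun j : Fin k => hsurj (-(LinearMap.proj j ∘ₗ T))
  have hdc : ∀ i j, ω (d j) (c i) = if i = j then -1 else 0 := fun i j => by
    rw [hd]
    simp only [LinearMap.neg_apply, LinearMap.comp_apply, hTc, LinearMap.proj_apply,
      Pi.single_apply, eq_comm (a := j)]
    split_ifs <;> simp
  have hcd : ∀ i j, ω (c i) (d j) = if i = j then 1 else 0 := fun i j => by
    rw [hskew, hdc]
    split_ifs <;> simp
  -- the correction by half of the Gram matrix of `d` makes the dual family isotropic
  let q : Fin k → W := fun j => d j + ∑ i, ((2⁻¹ : 𝕜) * ω (d i) (d j)) • c i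
  have hcq : ∀ i j, ω (c i) (q j) = if i = j then 1 else 0 := fun i j => by
    simp [q, hcd, hiso]
  have hqc : ∀ i j, ω (q j) (c i) = if i = j then -1 else 0 := fun i j => by
    rw [hskew, hcq]
    split_ifs <;> simp
  have hqq : ∀ i j, ω (q i) (q j) = 0 := fun i j => by
    have h1 : ∀ z, ω (q i) z = ω (d i) z + ∑ l, ((2⁻¹ : 𝕜) * ω (d l) (d i)) * ω (c l) z :=
      fun z => by
        simp only [q, map_add, map_sum, LinearMap.add_apply, LinearMap.sum_apply, map_smul,
          LinearMap.smul_apply, smul_eq_mul]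
    have h2 : ∀ z, ω z (q j) = ω z (d j) + ∑ l, ((2⁻¹ : 𝕜) * ω (d l) (d j)) * ω z (c l) :=
      fun z => by simp only [q, map_add, map_sum, map_smul, smul_eq_mul]
    rw [h1, h2 (d i)]
    simp only [hcq, hdc, mul_ite, mul_one, mul_zero, Finset.sum_ite_eq',
      Finset.mem_univ, if_true, mul_neg]
    rw [hskew (d j) (d i)]
    have : (2 : 𝕜) ≠ 0 := two_ne_zero
    field_simp
    ring
  have hli : LinearIndependent 𝕜 (Sum.elim c q) := by
    rw [Fintype.linearIndependent_iff]
    intro g hg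
    have hexp : ∑ i, g (.inl i) • c i + ∑ i, g (.inr i) • q i = 0 := by
      simpa [Fintype.sum_sum_type] using hg
    rintro (i | i)
    · have := congrArg (fun x => ω x (q i)) hexp
      simpa [hcq, hqq] using this
    · have := congrArg (ω (c i)) hexp
      simpa [hcq, hiso] using this
  refine ⟨basisOfLinearIndependentOfCardEqFinrank' _ hli (by simp [hk]), ⟨?_, ?_, ?_, ?_⟩, ?_⟩ <;>
    simp [hiso, hqq, hcq, hqc]

/-- The Plücker line of a subspace is spanned by the exterior product of any basis. -/
lemma pluckerLine_span {d : ℕ} {y : Fin d → W} :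
    pluckerLine d (Submodule.span 𝕜 (Set.range y)) =
      Submodule.span 𝕜 {exteriorPower.ιMulti 𝕜 d y} := by
  let p := Submodule.span 𝕜 (Set.range y)
  let y' : Fin d → p := fun i => ⟨y i, Submodule.subset_span ⟨i, rfl⟩⟩
  have hy' : Submodule.span 𝕜 (Set.range y') = ⊤ := by
    refine Submodule.map_injective_of_injective p.injective_subtype ?_
    rw [Submodule.map_span, ← Set.range_comp, Submodule.map_top, Submodule.range_subtype]
    rfl
  have h := exteriorPower.ιMulti_family_span_of_span (n := d) 𝕜 hy'
  have hr : Set.range (exteriorPower.ιMulti_family 𝕜 d y') = {exteriorPower.ιMulti 𝕜 d y'} := by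
    have hs : ∀ s : Set.powersetCard (Fin d) d,
        exteriorPower.ιMulti_family 𝕜 d y' s = exteriorPower.ιMulti 𝕜 d y' := fun s => by
      have : ⇑(Set.powersetCard.ofFinEmbEquiv.symm s : Fin d ↪o Fin d) = id :=
        (OrderEmbedding.strictMono _).range_inj strictMono_id |>.1 (by
          rw [Set.range_id, Set.range_eq_univ]
          exact Finite.surjective_of_injective (RelEmbedding.injective _))
      rw [exteriorPower.ιMulti_family, this]
      rfl
    ext z
    simp only [Set.mem_range, hs, Set.mem_singleton_iff]
    constructor
    · rintro ⟨_, rfl⟩; rfl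
    · rintro rfl
      exact ⟨⟨Finset.univ, by simp⟩, rfl⟩
  rw [pluckerLine, LinearMap.range_eq_map, ← h, hr, Submodule.map_span, Set.image_singleton,
    exteriorPower.map_apply_ιMulti]
  rfl

end SymplecticBases

section Lambda

variable (𝕜 : Type*) [Field 𝕜] (n : ℕ)

lemma lambdaForm_apply (x y : Fin (2 * n - 2) → 𝕜) :
    lambdaForm 𝕜 n x y = ∑ i, ∑ j, x i * lambdaMatrix 𝕜 n i j * y j := by
  rw [lambdaForm, Matrix.toBilin'_apply]

lemma lambdaMatrix_skew (i j : Fin (2 * n - 2)) :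
    lambdaMatrix 𝕜 n i j = -lambdaMatrix 𝕜 n j i := by
  simp only [lambdaMatrix, Matrix.of_apply]
  split_ifs <;> first | omega | simp

lemma lambdaForm_skew (x y : Fin (2 * n - 2) → 𝕜) :
    lambdaForm 𝕜 n x y = -lambdaForm 𝕜 n y x := by
  rw [lambdaForm_apply, lambdaForm_apply, Finset.sum_comm, ← Finset.sum_neg_distrib]
  refine Finset.sum_congr rfl fun i _ => ?_
  rw [← Finset.sum_neg_distrib]
  refine Finset.sum_congr rfl fun j _ => ?_
  rw [lambdaMatrix_skew]
  ring

/-- The form is the signed adjacency form of a path, so pairing with the basis vectors relates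
the coordinates at distance two; the path has an even number of vertices, and hence both parities
can be propagated from an end at which the coordinate vanishes. -/
lemma lambdaForm_nondegenerate (x : Fin (2 * n - 2) → 𝕜)
    (hx : ∀ y, lambdaForm 𝕜 n x y = 0) : x = 0 := by
  have hcol : ∀ j, ∑ i, x i * lambdaMatrix 𝕜 n i j = 0 := fun j => by
    have := hx (Pi.single j 1)
    rw [lambdaForm_apply] at this
    simpa [Pi.single_apply] using this
  let z : ℕ → 𝕜 := fun m => if h : m < 2 * n - 2 then x ⟨m, h⟩ else 0
  have hz : ∀ i : Fin (2 * n - 2), x i = z i := fun i => by simp [z]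
  have hz0 : ∀ m, 2 * n - 2 ≤ m → z m = 0 := fun m hm => by simp [z]; omega
  have key : ∀ j, j < 2 * n - 2 → (if j = 0 then 0 else z (j - 1)) + z (j + 1) = 0 := by
    intro j hj
    have h := hcol ⟨j, hj⟩
    have e : ∀ i : Fin (2 * n - 2), x i * lambdaMatrix 𝕜 n i ⟨j, hj⟩ =
        (if (i : ℕ) + 1 = j then (-1) ^ (j + 1) * z (j - 1) else 0) +
        (if (i : ℕ) = j + 1 then (-1) ^ (j + 1) * z (j + 1) else 0) := fun i => by
      rw [hz]
      simp only [lambdaMatrix, Matrix.of_apply]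
      split_ifs with h1 h2 h3 h3
      · omega
      · subst h1
        simp [pow_succ]
        ring
      · rw [‹(i : ℕ) = j + 1›]
        simp [pow_succ]
        ring
      · omega
      · omega
      · simp
    rw [Finset.sum_congr rfl fun i _ => e i, Finset.sum_add_distrib] at h
    have s1 : ∑ i : Fin (2 * n - 2), (if (i : ℕ) + 1 = j then (-1) ^ (j + 1) * z (j - 1) else 0) =
        (-1) ^ (j + 1) * if j = 0 then 0 else z (j - 1) := by
      by_cases h0 : j = 0
      · subst h0; simp
      · rw [Finset.sum_eq_single_of_mem (⟨j - 1, by omega⟩ : Fin (2 * n - 2)) (Finset.mem_univ _)]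
        · rw [if_pos (by simp; omega), if_neg h0]
        · intro i _ hi
          rw [if_neg]
          rintro rfl
          exact hi (Fin.ext (by simp))
    have s2 : ∑ i : Fin (2 * n - 2), (if (i : ℕ) = j + 1 then (-1) ^ (j + 1) * z (j + 1) else 0) =
        (-1) ^ (j + 1) * z (j + 1) := by
      by_cases h0 : j + 1 < 2 * n - 2
      · rw [Finset.sum_eq_single_of_mem (⟨j + 1, h0⟩ : Fin (2 * n - 2)) (Finset.mem_univ _)]
        · simp
        · intro i _ hi
          rw [if_neg]
          intro hh
          exact hi (Fin.ext hh)
      · rw [hz0 _ (by omega), mul_zero]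
        simp
    rw [s1, s2, ← mul_add] at h
    exact (mul_eq_zero.1 h).resolve_left (pow_ne_zero _ (by simp))
  have hodd : ∀ m, z (2 * m + 1) = 0 := by
    intro m
    induction m with
    | zero =>
      by_cases h : 0 < 2 * n - 2
      · simpa using key 0 h
      · exact hz0 _ (by omega)
    | succ m ih =>
      by_cases h : 2 * m + 2 < 2 * n - 2
      · simpa [ih, show 2 * m + 2 + 1 = 2 * (m + 1) + 1 by ring] using key (2 * m + 2) h
      · exact hz0 _ (by omega)
  have heven : ∀ d m, n ≤ m + d → z (2 * m) = 0 := by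
    intro d
    induction d with
    | zero => intro m hm; exact hz0 _ (by omega)
    | succ d ih =>
      intro m hm
      by_cases h : 2 * m + 1 < 2 * n - 2
      · simpa [show 2 * m + 1 + 1 = 2 * (m + 1) by ring, ih (m + 1) (by omega)] using
          key (2 * m + 1) h
      · exact hz0 _ (by omega)
  funext i
  rw [hz, Pi.zero_apply]
  obtain ⟨m, hm | hm⟩ := Nat.even_or_odd' (i : ℕ)
  · rw [hm]; exact heven n m (by omega)
  · rw [hm]; exact hodd m

variable {n}

lemma lambdaForm_vacuum (i j : Fin (n - 1)) :
    lambdaForm 𝕜 n (Pi.single (⟨2 * (i : ℕ) + 1, by omega⟩ : Fin (2 * n - 2)) 1)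
      (Pi.single (⟨2 * (j : ℕ) + 1, by omega⟩ : Fin (2 * n - 2)) 1) = 0 := by
  rw [lambdaForm, Matrix.toBilin'_single]
  simp only [lambdaMatrix, Matrix.of_apply]
  rw [if_neg (by omega), if_neg (by omega)]

lemma linearIndependent_vacuum : LinearIndependent 𝕜 fun i : Fin (n - 1) =>
    (Pi.single (⟨2 * (i : ℕ) + 1, by omega⟩ : Fin (2 * n - 2)) (1 : 𝕜) :
      Fin (2 * n - 2) → 𝕜) := by
  have := (Pi.basisFun 𝕜 (Fin (2 * n - 2))).linearIndependent.comp
    (fun i : Fin (n - 1) => (⟨2 * (i : ℕ) + 1, by omega⟩ : Fin (2 * n - 2)))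
    (fun i j h => Fin.ext (by simpa using h))
  simpa [Function.comp_def] using! this

/-- Every basis of a Lagrangian subspace is the image of `w_2, w_4, …` under a symplectic
transformation, so that its Plücker line lies in the projectivised orbit. -/
lemma pluckerLine_mem_projectiveOrbit [CharZero 𝕜] {c : Fin (n - 1) → Fin (2 * n - 2) → 𝕜}
    (hc : LinearIndependent 𝕜 c) (hiso : ∀ i j, lambdaForm 𝕜 n (c i) (c j) = 0) :
    pluckerLine (n - 1) (Submodule.span 𝕜 (Set.range fun i => embedV 𝕜 n (c i))) ∈
      projectiveOrbit 𝕜 n := by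
  have hk : Module.finrank 𝕜 (Fin (2 * n - 2) → 𝕜) = (n - 1) + (n - 1) := by simp; omega
  obtain ⟨b, hb, hb'⟩ := exists_isSymplecticBasis (lambdaForm_skew 𝕜 n)
    (lambdaForm_nondegenerate 𝕜 n) hk _ (linearIndependent_vacuum 𝕜) (lambdaForm_vacuum 𝕜)
  obtain ⟨b₁, hb₁, hb₁'⟩ := exists_isSymplecticBasis (lambdaForm_skew 𝕜 n)
    (lambdaForm_nondegenerate 𝕜 n) hk c hc hiso
  refine ⟨⟨_, hb.equiv_mem hb₁⟩, ?_⟩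
  rw [pluckerLine_span, exteriorRep_apply, vacuumVector]
  rw [exteriorPower.map_apply_ιMulti, exteriorPower.map_apply_ιMulti]
  congr 3
  funext i
  simp only [Function.comp_apply]
  rw [← hb' i, ← hb₁' i]
  simp

end Lambda

/-! ### Irreducibility of the span of the orbit -/

section ExteriorBasis

open Matrix

variable {𝕜 W : Type*} [Field 𝕜] [AddCommGroup W] [Module 𝕜 W]

/-- A submodule that is stable under a diagonal operator contains every basis vector whose
eigenvalue is simple and whose coordinate does not vanish on the submodule. -/
lemma Module.Basis.mem_of_repr_ne_zero {ι : Type*} [Fintype ι] (B : Module.Basis ι 𝕜 W)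
    (D : Module.End 𝕜 W) (μ : ι → 𝕜) (hD : ∀ s, D (B s) = μ s • B s) {s₀ : ι}
    (hμ : ∀ s, s ≠ s₀ → μ s ≠ μ s₀) (N : Submodule 𝕜 W) (hN : ∀ x ∈ N, D x ∈ N) {x : W}
    (hx : x ∈ N) (hx₀ : B.repr x s₀ ≠ 0) : B s₀ ∈ N := by
  classical
  have hrepr : ∀ y s, B.repr (D y) s = μ s * B.repr y s := fun y s => by
    have : B.coord s ∘ₗ D = μ s • B.coord s := B.ext fun i => by
      by_cases h : i = s
      · subst h; simp [hD]
      · simp [hD, Finsupp.single_eq_of_ne' h]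
    simpa using LinearMap.congr_fun this y
  -- applying `D - μ a` kills the coordinate at `a` and keeps the one at `s₀`
  have key : ∀ T : Finset ι, s₀ ∉ T →
      ∃ y ∈ N, B.repr y s₀ ≠ 0 ∧ ∀ s ∈ T, B.repr y s = 0 := by
    intro T
    induction T using Finset.induction_on with
    | empty => exact fun _ => ⟨x, hx, hx₀, by simp⟩
    | insert a T ha ih =>
      intro h
      rw [Finset.mem_insert, not_or] at h
      obtain ⟨y, hy, hy₀, hyT⟩ := ih h.2
      refine ⟨D y - μ a • y, N.sub_mem (hN y hy) (N.smul_mem _ hy), ?_, ?_⟩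
      · rw [map_sub, Finsupp.sub_apply, hrepr, map_smul, Finsupp.smul_apply, smul_eq_mul, ← sub_mul]
        exact mul_ne_zero (sub_ne_zero.2 (hμ a (Ne.symm h.1)).symm) hy₀
      · intro s hs
        rw [map_sub, Finsupp.sub_apply, hrepr, map_smul, Finsupp.smul_apply, smul_eq_mul, ← sub_mul]
        rcases Finset.mem_insert.1 hs with rfl | hs
        · rw [sub_self, zero_mul]
        · rw [hyT s hs, mul_zero]
  obtain ⟨y, hy, hy₀, hyT⟩ := key (Finset.univ.erase s₀) (by simp)
  have hys : y = B.repr y s₀ • B s₀ := by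
    conv_lhs => rw [← B.sum_repr y]
    refine Finset.sum_eq_single s₀ (fun s _ hs => ?_) (by simp)
    rw [hyT s (by simp [hs]), zero_smul]
  rw [hys] at hy
  exact (N.smul_mem_iff hy₀).1 hy

variable {I : Type*} [LinearOrder I]

lemma Module.Basis.exteriorPower_repr_ιMulti (b : Module.Basis I 𝕜 W) (d : ℕ) (y : Fin d → W)
    (S : Set.powersetCard I d) :
    (b.exteriorPower d).repr (exteriorPower.ιMulti 𝕜 d y) S =
      (Matrix.of fun i j => b.repr (y i) (Set.powersetCard.ofFinEmbEquiv.symm S j)).det := by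
  rw [exteriorPower.basis_repr_apply, exteriorPower.ιMultiDual_apply_ιMulti]
  rfl

/-- The matrix entries of `⋀^d f` are minors of the matrix of `f`, so that passing to exterior
powers commutes with taking adjoints. -/
lemma Module.Basis.toMatrix_exteriorPower_map_conjTranspose [Fintype I] [StarRing 𝕜]
    (b : Module.Basis I 𝕜 W) (d : ℕ)
    {f f' : W →ₗ[𝕜] W} (h : LinearMap.toMatrix b b f' = (LinearMap.toMatrix b b f)ᴴ) :
    LinearMap.toMatrix (b.exteriorPower d) (b.exteriorPower d) (exteriorPower.map d f') =
      (LinearMap.toMatrix (b.exteriorPower d) (b.exteriorPower d) (exteriorPower.map d f))ᴴ := by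
  have h' : ∀ i j, b.repr (f' (b j)) i = star (b.repr (f (b i)) j) := fun i j => by
    have := congrFun (congrFun h i) j
    simpa [LinearMap.toMatrix_apply] using this
  ext S T
  rw [Matrix.conjTranspose_apply, LinearMap.toMatrix_apply, LinearMap.toMatrix_apply,
    exteriorPower.basis_apply, exteriorPower.basis_apply, exteriorPower.map_apply_ιMulti_family,
    exteriorPower.map_apply_ιMulti_family, exteriorPower.ιMulti_family,
    exteriorPower.ιMulti_family, b.exteriorPower_repr_ιMulti, b.exteriorPower_repr_ιMulti,
    ← Matrix.det_conjTranspose]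
  congr 1
  ext i j
  simp [h']

end ExteriorBasis

section Irreducibility

open Matrix

variable {𝕜 W : Type*} [RCLike 𝕜] [AddCommGroup W] [Module 𝕜 W] {ω : LinearMap.BilinForm 𝕜 W}
  {k : ℕ} {b : Module.Basis (Fin k ⊕ Fin k) 𝕜 W}

lemma IsSymplecticBasis.mem_iff (hb : IsSymplecticBasis ω b) (g : W ≃ₗ[𝕜] W) :
    g ∈ symplecticGroupOf ω ↔
      LinearMap.toMatrix b b g.toLinearMap ∈ Matrix.symplecticGroup (Fin k) 𝕜 := by
  obtain ⟨h1, h2, h3, h4⟩ := hb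
  have hJ : LinearMap.BilinForm.toMatrix b ω = -Matrix.J (Fin k) 𝕜 := by
    ext i j
    rw [LinearMap.BilinForm.toMatrix_apply]
    rcases i with i | i <;> rcases j with j | j <;>
      simp [h1, h2, h3, h4, Matrix.J, Matrix.one_apply, eq_comm (a := i)]
    split_ifs <;> simp
  rw [SymplecticGroup.mem_iff']
  have hc := LinearMap.BilinForm.toMatrix_comp b b ω g.toLinearMap g.toLinearMap
  rw [hJ] at hc
  constructor
  · intro hg
    have : ω.comp g.toLinearMap g.toLinearMap = ω := LinearMap.ext₂ fun x y => hg x y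
    rw [this, hJ] at hc
    simpa [eq_comm] using hc
  · intro hg x y
    have : ω.comp g.toLinearMap g.toLinearMap = ω := by
      apply (LinearMap.BilinForm.toMatrix b).injective
      rw [hc, hJ]
      simpa using hg
    exact LinearMap.congr_fun₂ this x y

/-- The symplectic group is stable under the adjoint with respect to the Hermitian form for which
a symplectic basis is orthonormal. -/
lemma IsSymplecticBasis.exists_adjoint (hb : IsSymplecticBasis ω b) (g : symplecticGroupOf ω) :
    ∃ g' : symplecticGroupOf ω, LinearMap.toMatrix b b (g' : W ≃ₗ[𝕜] W).toLinearMap =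
      (LinearMap.toMatrix b b (g : W ≃ₗ[𝕜] W).toLinearMap)ᴴ := by
  have hg := (hb.mem_iff _).1 g.2
  set A := LinearMap.toMatrix b b (g : W ≃ₗ[𝕜] W).toLinearMap
  have hA : Aᴴ ∈ Matrix.symplecticGroup (Fin k) 𝕜 :=
    SymplecticGroup.transpose_mem (SymplecticGroup.map_mem hg (starRingEnd 𝕜))
  let f := Matrix.toLinearEquiv b Aᴴ (SymplecticGroup.symplectic_det hA)
  have hf : LinearMap.toMatrix b b f.toLinearMap = Aᴴ := LinearMap.toMatrix_toLin b b Aᴴ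
  exact ⟨⟨f, (hb.mem_iff _).2 (hf ▸ hA)⟩, hf⟩

/-- A symplectic basis, numbered so that the Lagrangian half `p₁, …, p_k` comes first. -/
noncomputable def Module.Basis.sumToFin (b : Module.Basis (Fin k ⊕ Fin k) 𝕜 W) :
    Module.Basis (Fin (k + k)) 𝕜 W :=
  b.reindex finSumFinEquiv

/-- The index of `p₁ ∧ ⋯ ∧ p_k` in the basis of the exterior power. -/
noncomputable def lagrangianIndex (k : ℕ) : Set.powersetCard (Fin (k + k)) k :=
  Set.powersetCard.ofFinEmbEquiv (Fin.castAddOrderEmb k)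

lemma lagrangianIndex_symm_apply (j : Fin k) :
    Set.powersetCard.ofFinEmbEquiv.symm (lagrangianIndex k) j = Fin.castAdd k j := by
  simp [lagrangianIndex]

lemma exteriorPower_lagrangianIndex (b : Module.Basis (Fin k ⊕ Fin k) 𝕜 W) :
    b.sumToFin.exteriorPower k (lagrangianIndex k) =
      exteriorPower.ιMulti 𝕜 k fun i => b (.inl i) := by
  rw [exteriorPower.basis_apply, exteriorPower.ιMulti_family]
  congr 1
  funext i
  simp [lagrangianIndex_symm_apply, Module.Basis.sumToFin]

lemma exists_natAdd_of_ne_lagrangianIndex {S : Set.powersetCard (Fin (k + k)) k}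
    (hS : S ≠ lagrangianIndex k) :
    ∃ j i, Set.powersetCard.ofFinEmbEquiv.symm S j = Fin.natAdd k i := by
  obtain ⟨a, haS, ha⟩ := (Set.powersetCard.exists_mem_notMem_iff_ne S _).mp hS
  obtain ⟨j, rfl⟩ := (Set.powersetCard.mem_range_ofFinEmbEquiv_symm_iff_mem S a).mpr haS
  refine ⟨j, ?_⟩
  induction h : Set.powersetCard.ofFinEmbEquiv.symm S j using Fin.addCases with
  | left i =>
    exfalso
    apply ha
    rw [h, ← Set.powersetCard.mem_range_ofFinEmbEquiv_symm_iff_mem]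
    exact ⟨i, lagrangianIndex_symm_apply i⟩
  | right i => exact ⟨i, rfl⟩

/-- The torus element `diag(2, …, 2, 1/2, …, 1/2)` separates the weight of `p₁ ∧ ⋯ ∧ p_k` from
all other weights of the exterior power. -/
lemma IsSymplecticBasis.exists_separating (hb : IsSymplecticBasis ω b) :
    ∃ (g : symplecticGroupOf ω) (μ : Set.powersetCard (Fin (k + k)) k → 𝕜),
      (∀ S, exteriorRep ω k g (b.sumToFin.exteriorPower k S) =
        μ S • b.sumToFin.exteriorPower k S) ∧
      ∀ S, S ≠ lagrangianIndex k → μ S ≠ μ (lagrangianIndex k) := by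
  let t : Fin k ⊕ Fin k → 𝕜 := Sum.elim (fun _ => 2) (fun _ => 2⁻¹)
  have ht : ∀ i, IsUnit (t i) := by
    rintro (i | i) <;> simp [t]
  let b' := b.isUnitSMul ht
  have hb' : IsSymplecticBasis ω b' := by
    obtain ⟨h1, h2, h3, h4⟩ := hb
    refine ⟨?_, ?_, ?_, ?_⟩ <;> intro i j <;>
      simp [b', Module.Basis.isUnitSMul_apply, t, h1, h2, h3, h4]
  let s : Fin (k + k) → 𝕜 := fun i => t (finSumFinEquiv.symm i)
  let g : symplecticGroupOf ω := ⟨_, hb.equiv_mem hb'⟩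
  have hg : ∀ i, (g : W ≃ₗ[𝕜] W) (b.sumToFin i) = s i • b.sumToFin i := fun i => by
    simp [g, s, b', Module.Basis.sumToFin, Module.Basis.isUnitSMul_apply]
  refine ⟨g, fun S => ∏ j, s (Set.powersetCard.ofFinEmbEquiv.symm S j), fun S => ?_, fun S hS => ?_⟩
  · rw [exteriorRep_apply, exteriorPower.basis_apply, exteriorPower.ιMulti_family,
      exteriorPower.map_apply_ιMulti, ← AlternatingMap.map_smul_univ]
    congr 1
    funext i
    exact hg _
  · intro h
    have hnorm := congrArg norm h
    rw [norm_prod, norm_prod] at hnorm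
    obtain ⟨j, i, hji⟩ := exists_natAdd_of_ne_lagrangianIndex hS
    have hl : ∀ i : Fin k, ‖s (Fin.castAdd k i)‖ = 2 := fun i => by simp [s, t]
    have hr : ∀ i : Fin k, ‖s (Fin.natAdd k i)‖ = 2⁻¹ := fun i => by
      simp only [s, finSumFinEquiv_symm_apply_natAdd]
      simp [t]
    refine absurd hnorm (ne_of_lt (Finset.prod_lt_prod (fun i _ => ?_) (fun i _ => ?_)
      ⟨j, Finset.mem_univ _, ?_⟩))
    · induction Set.powersetCard.ofFinEmbEquiv.symm S i using Fin.addCases with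
      | left i => rw [hl]; norm_num
      | right i => rw [hr]; norm_num
    · rw [lagrangianIndex_symm_apply, hl]
      induction Set.powersetCard.ofFinEmbEquiv.symm S i using Fin.addCases with
      | left i => rw [hl]
      | right i => rw [hr]; norm_num
    · rw [lagrangianIndex_symm_apply, hl, hji, hr]; norm_num

/-- A subrepresentation of the span of the orbit of `p₁ ∧ ⋯ ∧ p_k` contains this vector unless it
is zero: if the coordinate of `p₁ ∧ ⋯ ∧ p_k` does not vanish on it, then the torus extracts the
vector; if it vanishes, then, by stability of the group under adjoints, the subrepresentation is
orthogonal to the orbit, and hence to itself. -/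
lemma IsSymplecticBasis.eq_bot_or_mem (hb : IsSymplecticBasis ω b) (N : Submodule 𝕜 (⋀[𝕜]^k W))
    (hN : ∀ g : symplecticGroupOf ω, ∀ x ∈ N, exteriorRep ω k g x ∈ N)
    (hNF : N ≤ Submodule.span 𝕜 (Set.range fun g : symplecticGroupOf ω =>
      exteriorRep ω k g (exteriorPower.ιMulti 𝕜 k fun i => b (.inl i)))) :
    N = ⊥ ∨ exteriorPower.ιMulti 𝕜 k (fun i => b (.inl i)) ∈ N := by
  rw [← exteriorPower_lagrangianIndex] at hNF ⊢
  set B := b.sumToFin.exteriorPower k with hB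
  by_cases h : ∃ x ∈ N, B.repr x (lagrangianIndex k) ≠ 0
  · obtain ⟨x, hx, hx₀⟩ := h
    obtain ⟨g, μ, hg, hμ⟩ := hb.exists_separating
    exact Or.inr (B.mem_of_repr_ne_zero _ μ hg hμ N (hN g) hx hx₀)
  · push Not at h
    left
    rw [Submodule.eq_bot_iff]
    intro x hx
    have horth : ∀ y ∈ Submodule.span 𝕜 (Set.range fun g : symplecticGroupOf ω =>
        exteriorRep ω k g (B (lagrangianIndex k))), star ⇑(B.repr y) ⬝ᵥ ⇑(B.repr x) = 0 := by
      intro y hy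
      induction hy using Submodule.span_induction with
      | mem y hy =>
        obtain ⟨g, rfl⟩ := hy
        obtain ⟨g', hg'⟩ := hb.exists_adjoint g
        have hg'' : LinearMap.toMatrix b.sumToFin b.sumToFin (g' : W ≃ₗ[𝕜] W).toLinearMap =
            (LinearMap.toMatrix b.sumToFin b.sumToFin (g : W ≃ₗ[𝕜] W).toLinearMap)ᴴ := by
          ext i j
          have := congrFun (congrFun hg' (finSumFinEquiv.symm i)) (finSumFinEquiv.symm j)
          simpa [LinearMap.toMatrix_apply, Module.Basis.sumToFin] using this
        have hm := b.sumToFin.toMatrix_exteriorPower_map_conjTranspose k hg''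
        have h0 := h _ (hN g' x hx)
        change star ⇑(B.repr (exteriorRep ω k g (B (lagrangianIndex k)))) ⬝ᵥ ⇑(B.repr x) = 0
        rw [exteriorRep_apply] at h0 ⊢
        rw [← LinearMap.toMatrix_mulVec_repr B B] at h0
        rw [← LinearMap.toMatrix_mulVec_repr B B, Matrix.star_mulVec, ← Matrix.dotProduct_mulVec,
          ← hm, B.repr_self]
        rw [← h0]
        simp [dotProduct, Finsupp.single_apply, hB]
      | zero => simp
      | add y z _ _ hy hz =>
        rw [map_add, Finsupp.coe_add, star_add, add_dotProduct, hy, hz, add_zero]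
      | smul a y _ hy => rw [map_smul, Finsupp.coe_smul, star_smul, smul_dotProduct, hy, smul_zero]
    have hx0 := horth x (hNF hx)
    open ComplexOrder in rw [dotProduct_star_self_eq_zero] at hx0
    exact B.repr.map_eq_zero_iff.1 (DFunLike.coe_injective hx0)

/-- The exterior product is unchanged by a unipotent triangular substitution. -/
lemma ιMulti_eq_of_unitriangular (b : Module.Basis (Fin k ⊕ Fin k) 𝕜 W) (y : Fin k → W)
    (hy : ∀ i, y i - b (.inl i) ∈ Submodule.span 𝕜 ((fun j => b (.inl j)) '' Set.Iio i)) :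
    exteriorPower.ιMulti 𝕜 k y = exteriorPower.ιMulti 𝕜 k fun i => b (.inl i) := by
  have hzero : ∀ i (a : Fin k ⊕ Fin k), (∀ j < i, a ≠ .inl j) →
      b.repr (y i - b (.inl i)) a = 0 := by
    intro i a ha
    have : Submodule.span 𝕜 ((fun j => b (.inl j)) '' Set.Iio i) ≤ LinearMap.ker (b.coord a) := by
      rw [Submodule.span_le]
      rintro _ ⟨j, hj, rfl⟩
      simpa [Finsupp.single_apply] using fun h => ha j hj h.symm
    exact this (hy i)
  have hrepr : ∀ i a, b.repr (y i) a = b.repr (y i - b (.inl i)) a + if a = .inl i then 1 else 0 :=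
    fun i a => by simp [Finsupp.single_apply, eq_comm]
  apply (b.sumToFin.exteriorPower k).repr.injective
  ext S
  rw [Module.Basis.exteriorPower_repr_ιMulti]
  by_cases hS : S = lagrangianIndex k
  · subst hS
    rw [← exteriorPower_lagrangianIndex, Module.Basis.repr_self, Finsupp.single_eq_same]
    rw [Matrix.det_of_isLowerTriangular]
    · refine Finset.prod_eq_one fun i _ => ?_
      simp only [Matrix.of_apply, lagrangianIndex_symm_apply, Module.Basis.sumToFin,
        Module.Basis.repr_reindex_apply, finSumFinEquiv_symm_apply_castAdd]
      rw [hrepr, hzero _ _ (fun j hj h => hj.ne' (Sum.inl_injective h))]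
      simp
    · intro i j hij
      have hij' : i < j := hij
      simp only [Matrix.of_apply, lagrangianIndex_symm_apply, Module.Basis.sumToFin,
        Module.Basis.repr_reindex_apply, finSumFinEquiv_symm_apply_castAdd]
      rw [hrepr, hzero _ _ (fun l hl h => (hl.trans hij').ne' (Sum.inl_injective h)),
        if_neg (fun h => hij'.ne' (Sum.inl_injective h)), add_zero]
  · obtain ⟨j, a, hja⟩ := exists_natAdd_of_ne_lagrangianIndex hS
    rw [← exteriorPower_lagrangianIndex, Module.Basis.repr_self, Finsupp.single_eq_of_ne hS]
    refine Matrix.det_eq_zero_of_column_eq_zero j fun i => ?_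
    simp only [Matrix.of_apply, hja, Module.Basis.sumToFin,
        Module.Basis.repr_reindex_apply, finSumFinEquiv_symm_apply_natAdd]
    rw [hrepr, hzero _ _ (by simp)]
    simp

/-- The span of the orbit of a vector of the exterior power, as a subrepresentation. -/
noncomputable def orbitSpan (ω : LinearMap.BilinForm 𝕜 W) (d : ℕ) (v : ⋀[𝕜]^d W) :
    Subrepresentation (exteriorRep ω d) where
  toSubmodule := Submodule.span 𝕜 (Set.range fun g => exteriorRep ω d g v)
  apply_mem_toSubmodule := by
    intro g x hx
    induction hx using Submodule.span_induction with
    | mem y hy =>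
      obtain ⟨h, rfl⟩ := hy
      refine Submodule.subset_span ⟨g * h, ?_⟩
      simp only [map_mul, Module.End.mul_apply]
    | zero => simp
    | add y z _ _ hy hz => rw [map_add]; exact Submodule.add_mem _ hy hz
    | smul a y _ hy => rw [map_smul]; exact Submodule.smul_mem _ _ hy

lemma mem_orbitSpan (ω : LinearMap.BilinForm 𝕜 W) (d : ℕ) (v : ⋀[𝕜]^d W) :
    v ∈ (orbitSpan ω d v).toSubmodule :=
  Submodule.subset_span ⟨1, by simp⟩

lemma IsSymplecticBasis.isIrreducible_orbitSpan (hb : IsSymplecticBasis ω b) :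
    Representation.IsIrreducible
      (V := (orbitSpan ω k (exteriorPower.ιMulti 𝕜 k fun i => b (.inl i))).toSubmodule)
      (orbitSpan ω k (exteriorPower.ιMulti 𝕜 k fun i => b (.inl i))).toRepresentation := by
  set v := exteriorPower.ιMulti 𝕜 k fun i => b (.inl i) with hv
  have hv0 : v ≠ 0 := by
    rw [hv, ← exteriorPower_lagrangianIndex]
    exact Module.Basis.ne_zero _ _
  let v' : (orbitSpan ω k v).toSubmodule := ⟨v, mem_orbitSpan ω k v⟩
  refine { exists_pair_ne := ⟨⊥, ⊤, fun h => ?_⟩, eq_bot_or_eq_top := fun N => ?_ }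
  · have : v' ∈ (⊥ : Submodule 𝕜 (orbitSpan ω k v).toSubmodule) := by
      have h' := congrArg Subrepresentation.toSubmodule h
      rw [show (⊥ : Submodule 𝕜 (orbitSpan ω k v).toSubmodule) = ⊤ from h']
      trivial
    exact hv0 (congrArg Subtype.val ((Submodule.mem_bot 𝕜).1 this))
  · let N' := N.toSubmodule.map (orbitSpan ω k v).toSubmodule.subtype
    have hN' : ∀ g : symplecticGroupOf ω, ∀ x ∈ N', exteriorRep ω k g x ∈ N' := by
      rintro g _ ⟨x, hx, rfl⟩
      exact ⟨_, N.apply_mem_toSubmodule g hx, rfl⟩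
    rcases hb.eq_bot_or_mem N' hN' (Submodule.map_subtype_le _ _) with h | h
    · left
      apply Subrepresentation.toSubmodule_injective
      refine (Submodule.eq_bot_iff _).2 fun x hx => Subtype.ext ?_
      exact (Submodule.eq_bot_iff _).1 h _ ⟨x, hx, rfl⟩
    · right
      apply Subrepresentation.toSubmodule_injective
      change N.toSubmodule = ⊤
      rw [eq_top_iff]
      have hle : (orbitSpan ω k v).toSubmodule ≤ N' := by
        refine Submodule.span_le.2 ?_
        rintro _ ⟨g, rfl⟩
        exact hN' g _ h
      intro x _
      obtain ⟨y, hy, hyx⟩ := hle x.2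
      rwa [← Subtype.ext hyx]

lemma IsSymplecticBasis.isFundamentalRep_orbitSpan (hb : IsSymplecticBasis ω b) (l : Fin k)
    (hl : ∀ i, i ≤ l) :
    IsFundamentalRep (ω := ω)
      (M := (orbitSpan ω k (exteriorPower.ιMulti 𝕜 k fun i => b (.inl i))).toSubmodule)
      (orbitSpan ω k (exteriorPower.ιMulti 𝕜 k fun i => b (.inl i))).toRepresentation
      l ⟨_, mem_orbitSpan ω k (exteriorPower.ιMulti 𝕜 k fun i => b (.inl i))⟩ := by
  refine ⟨hb.isIrreducible_orbitSpan, b, hb, ?_, ?_, ?_⟩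
  · intro h
    refine Module.Basis.ne_zero (b.sumToFin.exteriorPower k) (lagrangianIndex k) ?_
    rw [exteriorPower_lagrangianIndex]
    exact congrArg Subtype.val h
  · intro g hg
    apply Subtype.ext
    change exteriorRep ω k g (exteriorPower.ιMulti 𝕜 k fun i => b (.inl i)) = _
    rw [exteriorRep_apply, exteriorPower.map_apply_ιMulti]
    exact ιMulti_eq_of_unitriangular b _ hg
  · intro g t hp _
    apply Subtype.ext
    change exteriorRep ω k g (exteriorPower.ιMulti 𝕜 k fun i => b (.inl i)) =
      (∏ i, (t i : 𝕜) ^ fundamentalWeight l i) • exteriorPower.ιMulti 𝕜 k fun i => b (.inl i)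
    rw [exteriorRep_apply, exteriorPower.map_apply_ιMulti]
    have : (⇑(g : W ≃ₗ[𝕜] W).toLinearMap ∘ fun i => b (.inl i)) =
        fun i => (t i : 𝕜) • b (.inl i) := funext hp
    rw [this, AlternatingMap.map_smul_univ]
    simp [fundamentalWeight, hl]

end Irreducibility

/-! ### Equilibria of networks with conductivities in `[0, ∞]` -/

section SymmetricForms

/-- A linear form that vanishes on the kernel of a symmetric bilinear form on a
finite-dimensional space is represented by it. -/
lemma LinearMap.BilinForm.exists_eq_of_ker_le {K X : Type*} [Field K] [AddCommGroup X] [Module K X]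
    [FiniteDimensional K X] (Q : LinearMap.BilinForm K X) (hQ : ∀ x y, Q x y = Q y x)
    (s : Module.Dual K X) (hs : ∀ x, Q x = 0 → s x = 0) : ∃ y, Q y = s := by
  change s ∈ LinearMap.range Q
  rw [← Subspace.dualCoannihilator_dualAnnihilator_eq (W := LinearMap.range Q),
    Submodule.mem_dualAnnihilator]
  intro x hx
  rw [Submodule.mem_dualCoannihilator] at hx
  refine hs x (LinearMap.ext fun y => ?_)
  rw [hQ]
  exact hx (Q y) ⟨y, rfl⟩

end SymmetricForms

namespace PlanarCircularGraph

variable {n : ℕ} (Γ : PlanarCircularGraph n)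

open Classical in
/-- The net flow out of the vertex `v` of a flow `f` along the edges, oriented from `src` to
`tgt`. -/
noncomputable def netFlow (f : Γ.Edge → ℝ) (v : Γ.Vert) : ℝ :=
  ∑ e, f e * ((if Γ.src e = v then 1 else 0) - (if Γ.tgt e = v then 1 else 0))

lemma sum_mul_netFlow (f : Γ.Edge → ℝ) (ψ : Γ.Vert → ℝ) :
    ∑ v, ψ v * Γ.netFlow f v = ∑ e, f e * (ψ (Γ.src e) - ψ (Γ.tgt e)) := by
  classical
  simp only [netFlow, Finset.mul_sum]
  rw [Finset.sum_comm]
  refine Finset.sum_congr rfl fun e _ => ?_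
  have : ∀ v, ψ v * (f e * ((if Γ.src e = v then 1 else 0) - (if Γ.tgt e = v then 1 else 0))) =
      (if Γ.src e = v then f e * ψ v else 0) - (if Γ.tgt e = v then f e * ψ v else 0) := by
    intro v
    split_ifs <;> ring
  simp only [this, Finset.sum_sub_distrib, Finset.sum_ite_eq, Finset.mem_univ, if_true]
  ring

lemma netFlow_sub (f f' : Γ.Edge → ℝ) (v : Γ.Vert) :
    Γ.netFlow (f - f') v = Γ.netFlow f v - Γ.netFlow f' v := by
  simp only [netFlow, ← Finset.sum_sub_distrib, Pi.sub_apply, sub_mul]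

/-- Ohm's law turns net flows into currents. -/
lemma netFlow_eq_current {w : Γ.Edge → ℝ≥0} {φ : Γ.Vert → ℝ} {f : Γ.Edge → ℝ}
    (hf : ∀ e, f e = w e * (φ (Γ.src e) - φ (Γ.tgt e))) : Γ.netFlow f = Γ.current w φ := by
  funext v
  refine Finset.sum_congr rfl fun e _ => ?_
  rw [hf]
  split_ifs <;> ring

lemma sum_eq_sum_bdry {g : Γ.Vert → ℝ} (hg : ∀ v, v ∉ Set.range Γ.bdry → g v = 0) :
    ∑ v, g v = ∑ i, g (Γ.bdry i) := by
  classical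
  refine Eq.trans ?_ (Finset.sum_map Finset.univ ⟨Γ.bdry, Γ.bdry_injective⟩ g)
  refine (Finset.sum_subset (Finset.subset_univ _) fun v _ hv => hg v ?_).symm
  simpa using hv

/-- An equilibrium of the network with conductivities `w ∈ [0, ∞]`, whose boundary vertices are
connected to sources of potential `h` through unit resistors: Ohm's law holds on the edges of
finite conductivity, the potential is constant along the edges of infinite conductivity (on which
the flow is arbitrary), Kirchhoff's law holds at the interior vertices, and the current that enters
at a boundary vertex is the difference of `h` and the potential. -/
structure IsEquilibrium (w : Γ.Edge → ℝ≥0∞) (h : Fin n → ℝ) (φ : Γ.Vert → ℝ)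
    (f : Γ.Edge → ℝ) : Prop where
  ohm : ∀ e, w e ≠ ⊤ → f e = (w e).toReal * (φ (Γ.src e) - φ (Γ.tgt e))
  contract : ∀ e, w e = ⊤ → φ (Γ.src e) = φ (Γ.tgt e)
  kirchhoff : ∀ v, v ∉ Set.range Γ.bdry → Γ.netFlow f v = 0
  boundary : ∀ i, φ (Γ.bdry i) + Γ.netFlow f (Γ.bdry i) = h i

/-- Equilibria exist: the potential is a critical point of the energy on the space of functions
which are constant along the edges of infinite conductivity, and the flows through these edges are
the Lagrange multipliers. -/
lemma exists_isEquilibrium (w : Γ.Edge → ℝ≥0∞) (h : Fin n → ℝ) :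
    ∃ φ f, Γ.IsEquilibrium w h φ f := by
  classical
  let d : Γ.Edge → Module.Dual ℝ (Γ.Vert → ℝ) := fun e =>
    (LinearMap.proj (Γ.src e) : (Γ.Vert → ℝ) →ₗ[ℝ] ℝ) - LinearMap.proj (Γ.tgt e)
  let p : Fin n → Module.Dual ℝ (Γ.Vert → ℝ) := fun i => LinearMap.proj (Γ.bdry i)
  -- `ENNReal.toReal ⊤ = 0`, so that the contracted edges do not contribute to the energy `Q`
  let S : Submodule ℝ (Γ.Vert → ℝ) := ⨅ e : {e // w e = ⊤}, LinearMap.ker (d e)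
  let Q : LinearMap.BilinForm ℝ (Γ.Vert → ℝ) :=
    ∑ e, (w e).toReal • (d e).smulRight (d e) + ∑ i, (p i).smulRight (p i)
  have hQ : ∀ x y, Q x y = ∑ e, (w e).toReal * (d e x * d e y) + ∑ i, p i x * p i y := by
    intro x y
    simp [Q, LinearMap.add_apply, LinearMap.sum_apply]
  let s : Module.Dual ℝ (Γ.Vert → ℝ) := ∑ i, h i • p i
  have hs : ∀ x, s x = ∑ i, h i * p i x := fun x => by simp [s, LinearMap.sum_apply]
  let QS : LinearMap.BilinForm ℝ S := Q.comp S.subtype S.subtype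
  have hQS : ∀ x y : S, QS x y = Q x y := fun _ _ => rfl
  obtain ⟨φ, hφ⟩ := QS.exists_eq_of_ker_le
    (fun x y => by
      rw [hQS, hQS, hQ, hQ]
      simp only [mul_comm])
    (s.comp S.subtype) (fun x hx => by
      have h0 : QS x x = 0 := by rw [hx]; rfl
      rw [hQS, hQ] at h0
      have h1 : 0 ≤ ∑ e, (w e).toReal * (d e x * d e x) := Finset.sum_nonneg fun e _ =>
        mul_nonneg ENNReal.toReal_nonneg (mul_self_nonneg _)
      have h2 : ∀ i ∈ Finset.univ, 0 ≤ p i x * p i x := fun i _ => mul_self_nonneg _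
      have h3 : ∑ i, p i x * p i x = 0 :=
        le_antisymm (by linarith) (Finset.sum_nonneg h2)
      have h4 := (Finset.sum_eq_zero_iff_of_nonneg h2).1 h3
      rw [LinearMap.comp_apply, Submodule.subtype_apply, hs]
      exact Finset.sum_eq_zero fun i hi => by rw [mul_self_eq_zero.1 (h4 i hi), mul_zero])
  have hspan : s - Q φ ∈ Submodule.span ℝ (Set.range fun e : {e // w e = ⊤} => d e) := by
    refine mem_span_of_iInf_ker_le_ker fun x hx => ?_
    have := LinearMap.congr_fun hφ ⟨x, hx⟩
    rw [LinearMap.mem_ker, LinearMap.sub_apply, sub_eq_zero]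
    exact this.symm
  obtain ⟨c, hc⟩ := (Submodule.mem_span_range_iff_exists_fun ℝ).1 hspan
  let f : Γ.Edge → ℝ := fun e => if he : w e = ⊤ then c ⟨e, he⟩ else (w e).toReal * d e φ
  have hf : ∀ x, ∑ e, f e * d e x = ∑ i, (h i - p i φ) * p i x := by
    intro x
    have h1 := LinearMap.congr_fun hc x
    rw [LinearMap.sub_apply, hs, hQ, LinearMap.sum_apply] at h1
    have h2 : ∀ e, f e * d e x = (w e).toReal * (d e φ * d e x) +
        if he : w e = ⊤ then c ⟨e, he⟩ * d e x else 0 := by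
      intro e
      by_cases he : w e = ⊤
      · simp [f, he]
      · simp [f, he, mul_assoc]
    have h3 : ∑ e, (if he : w e = ⊤ then c ⟨e, he⟩ * d e x else 0) =
        ∑ e : {e // w e = ⊤}, c e * d e x := by
      rw [Finset.sum_dite, Finset.sum_const_zero, add_zero]
      exact Finset.sum_bij (fun a _ => ⟨a.1, (Finset.mem_filter.1 a.2).2⟩) (by simp)
        (fun a _ b _ hab => Subtype.ext (congrArg (fun z : {e // w e = ⊤} => z.1) hab))
        (fun b _ => ⟨⟨b.1, by simpa using b.2⟩, by simp, rfl⟩) (fun _ _ => rfl)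
    rw [Finset.sum_congr rfl fun e _ => h2 e, Finset.sum_add_distrib, h3]
    simp only [LinearMap.smul_apply, smul_eq_mul] at h1
    rw [h1]
    simp only [sub_mul, Finset.sum_sub_distrib]
    ring
  have hnet : ∀ v, Γ.netFlow f v = ∑ i, (h i - p i φ) * if Γ.bdry i = v then 1 else 0 := by
    intro v
    have := hf (Pi.single v 1)
    simpa [d, p, Pi.single_apply, netFlow] using this
  refine ⟨φ, f, fun e he => by simp [f, he, d], fun e he => ?_, fun v hv => ?_, fun i => ?_⟩
  · have h1 := (Submodule.mem_iInf _).1 φ.2 ⟨e, he⟩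
    exact sub_eq_zero.1 h1
  · rw [hnet]
    exact Finset.sum_eq_zero fun i _ => by rw [if_neg fun hi => hv ⟨i, hi⟩, mul_zero]
  · rw [hnet]
    simp [Γ.bdry_injective.eq_iff, p]

variable {Γ}

lemma IsEquilibrium.sum_netFlow {w : Γ.Edge → ℝ≥0∞} {h : Fin n → ℝ} {φ : Γ.Vert → ℝ}
    {f : Γ.Edge → ℝ} (H : Γ.IsEquilibrium w h φ f) : ∑ i, Γ.netFlow f (Γ.bdry i) = 0 := by
  have := Γ.sum_mul_netFlow f fun _ => 1
  rw [← Γ.sum_eq_sum_bdry H.kirchhoff]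
  simpa using this

/-- Reciprocity: two equilibria of the same network pair symmetrically. -/
lemma IsEquilibrium.reciprocity {w : Γ.Edge → ℝ≥0∞} {h h' : Fin n → ℝ} {φ φ' : Γ.Vert → ℝ}
    {f f' : Γ.Edge → ℝ} (H : Γ.IsEquilibrium w h φ f) (H' : Γ.IsEquilibrium w h' φ' f') :
    ∑ i, φ' (Γ.bdry i) * Γ.netFlow f (Γ.bdry i) = ∑ i, φ (Γ.bdry i) * Γ.netFlow f' (Γ.bdry i) := by
  rw [← Γ.sum_eq_sum_bdry (g := fun v => φ' v * Γ.netFlow f v)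
      fun v hv => by rw [H.kirchhoff v hv, mul_zero],
    ← Γ.sum_eq_sum_bdry (g := fun v => φ v * Γ.netFlow f' v)
      fun v hv => by rw [H'.kirchhoff v hv, mul_zero], sum_mul_netFlow, sum_mul_netFlow]
  refine Finset.sum_congr rfl fun e _ => ?_
  by_cases he : w e = ⊤
  · rw [H.contract e he, H'.contract e he, sub_self, sub_self, mul_zero, mul_zero]
  · rw [H.ohm e he, H'.ohm e he]
    ring

/-- The energy identity for the difference of two equilibria with the same sources. -/
lemma IsEquilibrium.sum_sq_sub {w w' : Γ.Edge → ℝ≥0∞} {h : Fin n → ℝ} {φ φ' : Γ.Vert → ℝ}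
    {f f' : Γ.Edge → ℝ} (H : Γ.IsEquilibrium w h φ f) (H' : Γ.IsEquilibrium w' h φ' f') :
    ∑ i, (φ' (Γ.bdry i) - φ (Γ.bdry i)) ^ 2 =
      ∑ e, -((f' e - f e) * ((φ' (Γ.src e) - φ' (Γ.tgt e)) - (φ (Γ.src e) - φ (Γ.tgt e)))) := by
  have h1 := Γ.sum_mul_netFlow (f' - f) (φ' - φ)
  rw [Γ.sum_eq_sum_bdry (g := fun v => (φ' - φ) v * Γ.netFlow (f' - f) v) fun v hv => by
    rw [netFlow_sub, H.kirchhoff v hv, H'.kirchhoff v hv, sub_self, mul_zero]] at h1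
  rw [Finset.sum_neg_distrib, eq_neg_iff_add_eq_zero, ← neg_eq_zero, neg_add, ← sub_eq_add_neg,
    sub_eq_zero, ← Finset.sum_neg_distrib]
  refine Eq.trans ?_ (h1.trans ?_)
  · refine Finset.sum_congr rfl fun i _ => ?_
    rw [netFlow_sub, Pi.sub_apply]
    have e1 := H.boundary i
    have e2 := H'.boundary i
    have : Γ.netFlow f' (Γ.bdry i) - Γ.netFlow f (Γ.bdry i) =
      -(φ' (Γ.bdry i) - φ (Γ.bdry i)) := by linarith
    rw [this]
    ring
  · refine Finset.sum_congr rfl fun e _ => ?_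
    simp only [Pi.sub_apply]
    ring

lemma tendsto_coe_weight (w : Γ.Edge → ℝ≥0∞) (e : Γ.Edge) :
    Filter.Tendsto (fun u : Γ.Edge → ℝ≥0 => (u e : ℝ≥0∞))
      (Filter.comap (fun u i => (u i : ℝ≥0∞)) (nhds w)) (nhds (w e)) :=
  ((continuous_apply e).tendsto w).comp Filter.tendsto_comap

lemma neg_mul_sq_sub_mul_le {u : ℝ} (hu : 0 ≤ u) (a x : ℝ) (ha : u = 0 → a = 0) :
    -(u * x ^ 2) - a * x ≤ a ^ 2 / (4 * u) := by
  rcases hu.eq_or_lt with rfl | hu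
  · simp [ha rfl]
  · rw [le_div_iff₀ (by positivity)]
    nlinarith [sq_nonneg (2 * u * x + a)]

/-- The boundary potentials of the equilibria with fixed sources depend continuously on the
conductivities in `[0, ∞]`.  By the energy identity, the squared distance of the boundary
potentials is at most the sum of a term `a ^ 2 / (4 * u)` for each edge, where `u` is the
conductivity of the approximating network and `a` the defect in Ohm's law. -/
lemma IsEquilibrium.tendsto_bdry {w : Γ.Edge → ℝ≥0∞} {h : Fin n → ℝ} {φ : Γ.Vert → ℝ}
    {f : Γ.Edge → ℝ} (H : Γ.IsEquilibrium w h φ f) {φ' : (Γ.Edge → ℝ≥0) → Γ.Vert → ℝ}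
    {f' : (Γ.Edge → ℝ≥0) → Γ.Edge → ℝ}
    (H' : ∀ u, Γ.IsEquilibrium (fun e => (u e : ℝ≥0∞)) h (φ' u) (f' u)) (i : Fin n) :
    Filter.Tendsto (fun u => φ' u (Γ.bdry i))
      (Filter.comap (fun u i => (u i : ℝ≥0∞)) (nhds w)) (nhds (φ (Γ.bdry i))) := by
  set l := Filter.comap (fun (u : Γ.Edge → ℝ≥0) i => (u i : ℝ≥0∞)) (nhds w) with hl
  let a : (Γ.Edge → ℝ≥0) → Γ.Edge → ℝ := fun u e => u e * (φ (Γ.src e) - φ (Γ.tgt e)) - f e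
  have hfin : ∀ e, w e ≠ ⊤ →
      Filter.Tendsto (fun u : Γ.Edge → ℝ≥0 => (u e : ℝ)) l (nhds (w e).toReal) := fun e he => by
    have := (ENNReal.tendsto_toReal he).comp (tendsto_coe_weight w e)
    simpa [Function.comp_def] using this
  have hinf : ∀ e, w e = ⊤ →
      Filter.Tendsto (fun u : Γ.Edge → ℝ≥0 => (u e : ℝ)) l Filter.atTop := fun e he => by
    have := tendsto_coe_weight w e
    rw [he, ENNReal.tendsto_coe_nhds_top] at this
    exact NNReal.tendsto_coe_atTop.2 this
  have ha : ∀ e, ∀ᶠ u in l, (u e : ℝ) = 0 → a u e = 0 := by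
    intro e
    by_cases he : w e = ⊤
    · filter_upwards [(hinf e he).eventually_gt_atTop 0] with u hu h0
      exact absurd h0 hu.ne'
    · by_cases h0 : (w e).toReal = 0
      · refine Filter.Eventually.of_forall fun u hu => ?_
        simp [a, H.ohm e he, h0, hu]
      · filter_upwards [(hfin e he).eventually_ne h0] with u hu h0
        exact absurd h0 hu
  have herr : ∀ e, Filter.Tendsto (fun u => a u e ^ 2 / (4 * (u e : ℝ))) l (nhds 0) := by
    intro e
    by_cases he : w e = ⊤
    · -- the defect is constant while the conductivity tends to infinity
      have h1 : ∀ u : Γ.Edge → ℝ≥0, a u e = -f e := fun u => by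
        simp [a, H.contract e he]
      simp only [h1]
      exact Filter.Tendsto.div_atTop tendsto_const_nhds ((hinf e he).const_mul_atTop (by norm_num))
    · have h1 : ∀ u : Γ.Edge → ℝ≥0,
          a u e = (u e - (w e).toReal) * (φ (Γ.src e) - φ (Γ.tgt e)) := fun u => by
        simp only [a, H.ohm e he]
        ring
      simp only [h1]
      by_cases h0 : (w e).toReal = 0
      · -- the defect is proportional to the conductivity, so that the term is linear in it
        have h2 : ∀ u : Γ.Edge → ℝ≥0,
            ((u e - (w e).toReal) * (φ (Γ.src e) - φ (Γ.tgt e))) ^ 2 / (4 * (u e : ℝ)) =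
              u e * ((φ (Γ.src e) - φ (Γ.tgt e)) ^ 2 / 4) := fun u => by
          rw [h0, sub_zero]
          rcases eq_or_ne (u e : ℝ) 0 with hu | hu
          · simp [hu]
          · field_simp
        simp only [h2]
        simpa [h0] using (hfin e he).mul_const ((φ (Γ.src e) - φ (Γ.tgt e)) ^ 2 / 4)
      · have h2 := (((hfin e he).sub_const (w e).toReal).mul_const
          (φ (Γ.src e) - φ (Γ.tgt e))).pow 2
        simpa [Pi.div_def] using h2.div ((hfin e he).const_mul 4) (by simpa using h0)
  have hbound : ∀ᶠ u in l, (φ' u (Γ.bdry i) - φ (Γ.bdry i)) ^ 2 ≤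
      ∑ e, a u e ^ 2 / (4 * (u e : ℝ)) := by
    filter_upwards [Filter.eventually_all.2 ha] with u hu
    refine (Finset.single_le_sum (f := fun i => (φ' u (Γ.bdry i) - φ (Γ.bdry i)) ^ 2)
      (fun i _ => sq_nonneg _) (Finset.mem_univ i)).trans ?_
    rw [H.sum_sq_sub (H' u)]
    refine Finset.sum_le_sum fun e _ => ?_
    refine le_trans (le_of_eq ?_) (neg_mul_sq_sub_mul_le (u e).2 (a u e)
      ((φ' u (Γ.src e) - φ' u (Γ.tgt e)) - (φ (Γ.src e) - φ (Γ.tgt e))) (hu e))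
    rw [(H' u).ohm e ENNReal.coe_ne_top, ENNReal.coe_toReal]
    simp only [a, NNReal.val_eq_coe]
    ring
  have hsq : Filter.Tendsto (fun u => (φ' u (Γ.bdry i) - φ (Γ.bdry i)) ^ 2) l (nhds 0) := by
    refine tendsto_of_tendsto_of_tendsto_of_le_of_le' tendsto_const_nhds
      (by simpa using tendsto_finsetSum Finset.univ fun e _ => herr e)
      (Filter.Eventually.of_forall fun u => sq_nonneg _) hbound
  rw [tendsto_iff_norm_sub_tendsto_zero]
  simpa [Real.sqrt_sq_eq_abs] using hsq.sqrt

end PlanarCircularGraph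

/-! ### Boundary data as vectors of the symplectic space -/

section Coordinates

variable {n : ℕ}

lemma embedV_apply {K : Type*} [Field K] (c : ℕ → K) (m : Fin (2 * n)) :
    embedV K n (fun i => c i) m =
      (if (m : ℕ) < 2 * n - 2 then c m else 0) + if 2 ≤ (m : ℕ) then c (m - 2) else 0 := by
  have hs : embedV K n (fun i => c i) m = ∑ i : Fin (2 * n - 2),
      ((if (i : ℕ) = m then c m else 0) + if (i : ℕ) + 2 = m then c (m - 2) else 0) := by
    simp only [embedV, Matrix.vecMulLinear_apply, Matrix.vecMul, dotProduct, basisMatrix,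
      Matrix.of_apply]
    refine Finset.sum_congr rfl fun i _ => ?_
    by_cases h1 : (i : ℕ) = m
    · rw [if_pos (Or.inl h1.symm), if_pos h1, if_neg (by omega), h1]
      ring
    · by_cases h2 : (i : ℕ) + 2 = m
      · rw [if_pos (Or.inr h2.symm), if_neg h1, if_pos h2, ← h2]
        simp
      · rw [if_neg (by omega), if_neg h1, if_neg h2]
        ring
  rw [hs, Finset.sum_add_distrib]
  congr 1
  · split_ifs with h
    · rw [Finset.sum_eq_single_of_mem (⟨m, h⟩ : Fin (2 * n - 2)) (Finset.mem_univ _)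
        fun i _ hi => if_neg fun h' => hi (Fin.ext h')]
      simp
    · exact Finset.sum_eq_zero fun i _ => if_neg (by omega)
  · split_ifs with h
    · rw [Finset.sum_eq_single_of_mem (⟨m - 2, by omega⟩ : Fin (2 * n - 2)) (Finset.mem_univ _)
        fun i _ hi => if_neg fun h' => hi (Fin.ext (by simp; omega))]
      exact if_pos (by simp; omega)
    · exact Finset.sum_eq_zero fun i _ => if_neg (by omega)

lemma embedV_injective (K : Type*) [Field K] : Function.Injective (embedV K n) := by
  rw [injective_iff_map_eq_zero]
  intro x hx
  let c : ℕ → K := fun m => if h : m < 2 * n - 2 then x ⟨m, h⟩ else 0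
  have hc : x = fun i : Fin (2 * n - 2) => c i := by funext i; simp [c]
  have h0 : ∀ m, m < 2 * n - 2 → c m = 0 := by
    intro m
    induction m using Nat.strong_induction_on with
    | _ m ih =>
      intro hm
      have h := congrFun hx (⟨m, by omega⟩ : Fin (2 * n))
      rw [hc, embedV_apply, if_pos hm] at h
      by_cases h2 : 2 ≤ m
      · simpa [h2, ih (m - 2) (by omega) (by omega)] using h
      · simpa [h2] using h
  rw [hc]
  exact funext fun i => h0 i i.2

lemma lambdaForm_eq_sum_range {K : Type*} [Field K] (c c' : ℕ → K) :
    lambdaForm K n (fun i => c i) (fun i => c' i) =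
      ∑ m ∈ Finset.range (2 * n - 3), (-1) ^ m * (c m * c' (m + 1) - c (m + 1) * c' m) := by
  have hinner : ∀ i : Fin (2 * n - 2), ∑ j : Fin (2 * n - 2), c i * lambdaMatrix K n i j * c' j =
      (if (i : ℕ) < 2 * n - 3 then (-1) ^ (i : ℕ) * (c i * c' (i + 1)) else 0) -
        if 1 ≤ (i : ℕ) then (-1) ^ ((i : ℕ) - 1) * (c i * c' (i - 1)) else 0 := by
    intro i
    have : ∀ j : Fin (2 * n - 2), c i * lambdaMatrix K n i j * c' j =
        (if (j : ℕ) = i + 1 then (-1) ^ (i : ℕ) * (c i * c' (i + 1)) else 0) -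
        if (j : ℕ) + 1 = i then (-1) ^ ((i : ℕ) - 1) * (c i * c' (i - 1)) else 0 := by
      intro j
      simp only [lambdaMatrix, Matrix.of_apply]
      by_cases h1 : (i : ℕ) + 1 = j
      · rw [if_pos h1, if_pos h1.symm, if_neg (by omega), ← h1]
        ring
      · by_cases h2 : (j : ℕ) + 1 = i
        · rw [if_neg h1, if_pos h2, if_neg (by omega), if_pos h2, ← h2]
          simp
          ring
        · rw [if_neg h1, if_neg h2, if_neg (by omega), if_neg h2]
          ring
    rw [Finset.sum_congr rfl fun j _ => this j, Finset.sum_sub_distrib]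
    congr 1
    · split_ifs with h
      · rw [Finset.sum_eq_single_of_mem (⟨i + 1, by omega⟩ : Fin (2 * n - 2)) (Finset.mem_univ _)
          fun j _ hj => if_neg fun h' => hj (Fin.ext h')]
        simp
      · exact Finset.sum_eq_zero fun j _ => if_neg (by omega)
    · split_ifs with h
      · rw [Finset.sum_eq_single_of_mem (⟨i - 1, by omega⟩ : Fin (2 * n - 2)) (Finset.mem_univ _)
          fun j _ hj => if_neg fun h' => hj (Fin.ext (by simp; omega))]
        exact if_pos (by simp; omega)
      · exact Finset.sum_eq_zero fun j _ => if_neg (by omega)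
  rw [lambdaForm_apply, Finset.sum_congr rfl fun i _ => hinner i, Finset.sum_sub_distrib,
    Fin.sum_univ_eq_sum_range (fun i => if i < 2 * n - 3 then (-1) ^ i * (c i * c' (i + 1)) else 0),
    Fin.sum_univ_eq_sum_range
      (fun i => if 1 ≤ i then (-1) ^ (i - 1) * (c i * c' (i - 1)) else 0)]
  rcases Nat.eq_zero_or_pos (2 * n - 2) with h0 | h0
  · rw [h0, show 2 * n - 3 = 0 by omega]
    simp
  · -- the terms above and below the diagonal are matched by an index shift
    obtain ⟨k, hk⟩ : ∃ k, 2 * n - 2 = k + 1 := ⟨2 * n - 3, by omega⟩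
    rw [hk, show 2 * n - 3 = k by omega, Finset.sum_range_succ, Finset.sum_range_succ']
    simp only [lt_irrefl, if_false, add_zero, mul_sub, Finset.sum_sub_distrib,
      Nat.le_add_left, if_true, Nat.add_sub_cancel, nonpos_iff_eq_zero, one_ne_zero]
    congr 1
    exact Finset.sum_congr rfl fun i hi => if_pos (Finset.mem_range.1 hi)

variable [NeZero n]

/-- The coordinates, with respect to `w_1, w_2, …` and numbered from `0`, of the vector of `V` that
belongs to the boundary potentials `U` and the boundary currents `I`: in even position the partial
sums of the currents, in odd position the potential differences to the first boundary vertex, up to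
signs.  The boundary vertices are continued cyclically. -/
noncomputable def boundaryCoord (U I : Fin n → ℝ) (m : ℕ) : ℝ :=
  if m % 2 = 0 then (-1) ^ (m / 2 + 1) * ∑ i ∈ Finset.range (m / 2 + 1), I (Fin.ofNat n i)
  else (-1) ^ (m / 2 + 1) * (U (Fin.ofNat n 0) - U (Fin.ofNat n (m / 2 + 1)))

lemma boundaryCoord_even (U I : Fin n → ℝ) (b : ℕ) :
    boundaryCoord U I (2 * b) = (-1) ^ (b + 1) * ∑ i ∈ Finset.range (b + 1), I (Fin.ofNat n i) := by
  simp [boundaryCoord]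

lemma boundaryCoord_odd (U I : Fin n → ℝ) (b : ℕ) :
    boundaryCoord U I (2 * b + 1) =
      (-1) ^ (b + 1) * (U (Fin.ofNat n 0) - U (Fin.ofNat n (b + 1))) := by
  rw [boundaryCoord, if_neg (by omega), show (2 * b + 1) / 2 = b by omega]

lemma ofNat_fin_val (i : Fin n) : Fin.ofNat n i = i := by simp

lemma sum_range_ofNat (I : Fin n → ℝ) : ∑ i ∈ Finset.range n, I (Fin.ofNat n i) = ∑ i, I i := by
  rw [← Fin.sum_univ_eq_sum_range fun i => I (Fin.ofNat n i)]
  simp only [ofNat_fin_val]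

/-- The vector of `V` that belongs to boundary potentials and boundary currents. -/
noncomputable def boundaryVector : (Fin n → ℝ) × (Fin n → ℝ) →ₗ[ℝ] (Fin (2 * n - 2) → ℝ) where
  toFun p m := boundaryCoord p.1 p.2 m
  map_add' p q := by
    funext m
    simp only [boundaryCoord, Prod.fst_add, Prod.snd_add, Pi.add_apply, Finset.sum_add_distrib]
    split_ifs <;> ring
  map_smul' a p := by
    funext m
    simp only [boundaryCoord, Prod.smul_fst, Prod.smul_snd, Pi.smul_apply, smul_eq_mul,
      ← Finset.mul_sum, RingHom.id_apply]
    split_ifs <;> ring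

lemma boundaryVector_apply (U I : Fin n → ℝ) :
    boundaryVector (U, I) = fun m : Fin (2 * n - 2) => boundaryCoord U I m := rfl

/-- The symplectic form is, by summation by parts, the canonical pairing of potentials and
currents. -/
lemma lambdaForm_boundaryVector {U I U' I' : Fin n → ℝ} (hI : ∑ i, I i = 0) (hI' : ∑ i, I' i = 0) :
    lambdaForm ℝ n (boundaryVector (U, I)) (boundaryVector (U', I')) =
      ∑ i, U' i * I i - ∑ i, U i * I' i := by
  rw [boundaryVector_apply, boundaryVector_apply, lambdaForm_eq_sum_range]
  obtain ⟨k, rfl⟩ : ∃ k, n = k + 1 := ⟨n - 1, by have := NeZero.pos n; omega⟩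
  let u : ℕ → ℝ := fun b => U (Fin.ofNat (k + 1) b)
  let u' : ℕ → ℝ := fun b => U' (Fin.ofNat (k + 1) b)
  let j : ℕ → ℝ := fun b => I (Fin.ofNat (k + 1) b)
  let j' : ℕ → ℝ := fun b => I' (Fin.ofNat (k + 1) b)
  have hj : ∑ i ∈ Finset.range (k + 1), j i = 0 := by rw [sum_range_ofNat, hI]
  have hj' : ∑ i ∈ Finset.range (k + 1), j' i = 0 := by rw [sum_range_ofNat, hI']
  have key : ∀ b, ∑ m ∈ Finset.range (2 * b), (-1) ^ m *
      (boundaryCoord U I m * boundaryCoord U' I' (m + 1) -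
        boundaryCoord U I (m + 1) * boundaryCoord U' I' m) =
      ∑ i ∈ Finset.range (b + 1), ((u 0 - u i) * j' i - j i * (u' 0 - u' i)) := by
    intro b
    induction b with
    | zero => simp
    | succ b ih =>
      rw [show 2 * (b + 1) = 2 * b + 1 + 1 by ring, Finset.sum_range_succ, Finset.sum_range_succ, ih,
        Finset.sum_range_succ _ (b + 1), show 2 * b + 1 + 1 = 2 * (b + 1) by ring]
      simp only [boundaryCoord_even, boundaryCoord_odd]
      rw [Finset.sum_range_succ _ (b + 1), Finset.sum_range_succ _ (b + 1)]
      have hs : ((-1 : ℝ) ^ b) ^ 2 = 1 := by rw [← pow_mul, mul_comm, pow_mul]; simp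
      have hs2 : ((-1 : ℝ) ^ (2 * b)) = 1 := by rw [pow_mul]; simp
      simp only [pow_succ, hs2, u, u', j, j']
      linear_combination
        ((u 0 - u (b + 1)) * j' (b + 1) - (u' 0 - u' (b + 1)) * j (b + 1)) * hs
  have hlast : ∑ m ∈ Finset.range (2 * (k + 1) - 3), (-1) ^ m *
      (boundaryCoord U I m * boundaryCoord U' I' (m + 1) -
        boundaryCoord U I (m + 1) * boundaryCoord U' I' m) =
      ∑ i ∈ Finset.range (k + 1), ((u 0 - u i) * j' i - j i * (u' 0 - u' i)) := by
    rw [← key k]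
    rcases k with _ | k
    · simp
    · rw [show 2 * (k + 1 + 1) - 3 = 2 * k + 1 by omega, show 2 * (k + 1) = 2 * k + 1 + 1 by ring,
        Finset.sum_range_succ _ (2 * k + 1), show 2 * k + 1 + 1 = 2 * (k + 1) by ring,
        boundaryCoord_even, boundaryCoord_even]
      -- the last partial sums are the total currents, which vanish
      rw [show ∑ i ∈ Finset.range (k + 1 + 1), I (Fin.ofNat (k + 1 + 1) i) = 0 from hj,
        show ∑ i ∈ Finset.range (k + 1 + 1), I' (Fin.ofNat (k + 1 + 1) i) = 0 from hj']
      ring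
  rw [hlast, ← sum_range_ofNat fun i => U' i * I i, ← sum_range_ofNat fun i => U i * I' i]
  simp only [sub_mul, mul_sub, Finset.sum_sub_distrib, ← Finset.mul_sum, ← Finset.sum_mul, hj, hj']
  have e1 : ∑ i ∈ Finset.range (k + 1), j i * u' i =
      ∑ i ∈ Finset.range (k + 1), U' (Fin.ofNat (k + 1) i) * I (Fin.ofNat (k + 1) i) :=
    Finset.sum_congr rfl fun i _ => mul_comm _ _
  rw [e1]
  ring

/-- The vector determines the currents, and the potentials up to a constant. -/
lemma eq_of_boundaryVector_eq_zero {U I : Fin n → ℝ} (hI : ∑ i, I i = 0)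
    (h : boundaryVector (U, I) = 0) : I = 0 ∧ ∀ i, U i = U 0 := by
  have hm : ∀ m, m < 2 * n - 2 → boundaryCoord U I m = 0 := fun m hm =>
    congrFun h (⟨m, hm⟩ : Fin (2 * n - 2))
  have hJ : ∀ b, b ≤ n → ∑ i ∈ Finset.range b, I (Fin.ofNat n i) = 0 := by
    intro b hb
    rcases b with _ | b
    · simp
    · rcases hb.eq_or_lt with hb' | hb'
      · rw [hb', sum_range_ofNat, hI]
      · have := hm (2 * b) (by omega)
        rw [boundaryCoord_even] at this
        exact (mul_eq_zero.1 this).resolve_left (pow_ne_zero _ (by simp))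
  constructor
  · funext i
    have h1 := hJ i i.2.le
    have h2 := hJ (i + 1) i.2
    rw [Finset.sum_range_succ, h1, zero_add, ofNat_fin_val] at h2
    exact h2
  · intro i
    obtain ⟨m, hi⟩ := i
    rcases m with _ | b
    · rfl
    · have := hm (2 * b + 1) (by omega)
      rw [boundaryCoord_odd] at this
      have h3 := (mul_eq_zero.1 this).resolve_left (pow_ne_zero _ (by simp))
      have h4 := ofNat_fin_val (⟨b + 1, hi⟩ : Fin n)
      rw [← h4]
      exact (sub_eq_zero.1 h3).symm

lemma embedV_boundaryVector_even {U I : Fin n → ℝ} (hI : ∑ i, I i = 0) (j : Fin n)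
    (m : Fin (2 * n)) (hm : (m : ℕ) = 2 * j) :
    embedV ℝ n (boundaryVector (U, I)) m = (-1) ^ ((j : ℕ) + 1) * I j := by
  rw [boundaryVector_apply, embedV_apply, hm]
  have h1 : (if 2 * (j : ℕ) < 2 * n - 2 then boundaryCoord U I (2 * j) else 0) =
      boundaryCoord U I (2 * j) := by
    split_ifs with h
    · rfl
    · rw [boundaryCoord_even, show (j : ℕ) + 1 = n by omega, sum_range_ofNat, hI, mul_zero]
  rw [h1, boundaryCoord_even, Finset.sum_range_succ, ofNat_fin_val]
  obtain ⟨b, hb⟩ := j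
  rcases b with _ | b
  · simp
  · simp only [show 2 ≤ 2 * (b + 1) by omega, if_true, show 2 * (b + 1) - 2 = 2 * b by omega,
      boundaryCoord_even]
    ring

lemma embedV_boundaryVector_odd (U I : Fin n → ℝ) (j : Fin n)
    (m : Fin (2 * n)) (hm : (m : ℕ) = 2 * j + 1) :
    embedV ℝ n (boundaryVector (U, I)) m =
      (-1) ^ ((j : ℕ) + 1) * (U j - U (Fin.ofNat n (j + 1))) := by
  rw [boundaryVector_apply, embedV_apply, hm]
  have h1 : (if 2 * (j : ℕ) + 1 < 2 * n - 2 then boundaryCoord U I (2 * j + 1) else 0) =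
      boundaryCoord U I (2 * j + 1) := by
    split_ifs with h
    · rfl
    · rw [boundaryCoord_odd, show (j : ℕ) + 1 = n by omega]
      have : Fin.ofNat n n = Fin.ofNat n 0 := by ext; simp
      rw [this, sub_self, mul_zero]
  rw [h1, boundaryCoord_odd]
  have hj := ofNat_fin_val j
  obtain ⟨b, hb⟩ := j
  rcases b with _ | b
  · simp
  · simp only [show 2 ≤ 2 * (b + 1) + 1 by omega, if_true,
      show 2 * (b + 1) + 1 - 2 = 2 * b + 1 by omega, boundaryCoord_odd]
    simp only at hj
    rw [hj]
    ring

/-- The signed combination of the rows of `Ω_n` with the potentials as coefficients is the vector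
that belongs to these potentials and the resulting currents. -/
lemma sum_smul_omegaMatrix {x : Matrix (Fin n) (Fin n) ℝ} (hx : x.IsSymm) (U : Fin n → ℝ)
    (hI : ∑ i, x.mulVec U i = 0) :
    ∑ i : Fin n, ((-1) ^ ((i : ℕ) + 1) * U i) • omegaMatrix x i =
      embedV ℝ n (boundaryVector (U, x.mulVec U)) := by
  funext m
  rw [Finset.sum_apply]
  have hj : (m : ℕ) / 2 < n := by omega
  rcases Nat.mod_two_eq_zero_or_one m with h | h
  · rw [embedV_boundaryVector_even hI ⟨m / 2, hj⟩ m (by simp; omega)]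
    simp only [Pi.smul_apply, smul_eq_mul, omegaMatrix, Matrix.of_apply, h, if_true, Matrix.mulVec,
      dotProduct, Finset.mul_sum]
    refine Finset.sum_congr rfl fun i _ => ?_
    rw [hx.apply]
    have hs : ((-1 : ℝ) ^ (i : ℕ)) * ((-1 : ℝ) ^ (i : ℕ)) = 1 := by
      rw [← mul_pow]; simp
    simp only [pow_add]
    linear_combination ((-1 : ℝ) ^ ((m : ℕ) / 2) * (-1) ^ 1 * U i * x ⟨m / 2, hj⟩ i) * hs
  · rw [embedV_boundaryVector_odd U _ ⟨m / 2, hj⟩ m (by simp; omega)]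
    set j : Fin n := ⟨m / 2, hj⟩
    have hv : (m : ℕ) / 2 = j := rfl
    have hrow : ∀ i : Fin n, ((-1 : ℝ) ^ ((i : ℕ) + 1) * U i) * omegaMatrix x i m =
        (if j = i then (-1) ^ ((i : ℕ) + 1) * U i else 0) +
        (if Fin.ofNat n (j + 1) = i then (-1) ^ (j : ℕ) * U i else 0) := by
      intro i
      have e1 : (Fin.ofNat n (j + 1) = i) ↔
          ((j : ℕ) + 1 = i ∨ ((i : ℕ) = 0 ∧ (j : ℕ) + 1 = n)) := by
        rw [Fin.ext_iff, Fin.val_ofNat]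
        rcases (Nat.succ_le_of_lt j.2).eq_or_lt with h' | h'
        · rw [show (j : ℕ) + 1 = n from h', Nat.mod_self]
          omega
        · rw [Nat.mod_eq_of_lt h']
          omega
      have e2 : (j = i) ↔ ((j : ℕ) = i) := Fin.ext_iff
      simp only [omegaMatrix, Matrix.of_apply, h, one_ne_zero, if_false, e1, e2, hv]
      by_cases a1 : (j : ℕ) + 1 = i
      · have a2 : ¬ ((i : ℕ) = 0 ∧ (j : ℕ) + 1 = n) := by omega
        have a3 : ¬ ((j : ℕ) = i) := by omega
        rw [if_neg a3, if_pos a1, if_neg a2, if_neg a3, if_pos (Or.inl a1), ← a1]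
        ring
      · by_cases a2 : (i : ℕ) = 0 ∧ (j : ℕ) + 1 = n
        · have hn : (-1 : ℝ) ^ n = (-1) ^ ((j : ℕ) + 1) := by rw [a2.2]
          rw [if_neg a1, if_pos a2, if_pos (Or.inr a2), hn, a2.1]
          split_ifs <;> ring
        · simp only [a1, a2, if_false, or_self, add_zero]
          split_ifs <;> simp
    simp only [Pi.smul_apply, smul_eq_mul, hrow, Finset.sum_add_distrib, Finset.sum_ite_eq,
      Finset.mem_univ, if_true]
    ring

end Coordinates

/-! ### Limits in the Grassmannian and the points of networks -/

section Limits

/-- Limits in the Grassmannian are unique: a vector of one limit outside another limit would be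
independent of a basis of it, and independence is an open condition. -/
lemma GrassmannianTendsto.unique {𝕜 : Type*} [RCLike 𝕜] {m d : ℕ} {α : Type*}
    {f : α → Submodule 𝕜 (Fin m → 𝕜)} {l : Filter α} [l.NeBot] {p q : Submodule 𝕜 (Fin m → 𝕜)}
    (hp : GrassmannianTendsto d f l p) (hq : GrassmannianTendsto d f l q) : p = q := by
  have key : ∀ {p q : Submodule 𝕜 (Fin m → 𝕜)}, GrassmannianTendsto d f l p →
      GrassmannianTendsto d f l q → p ≤ q := by
    rintro p q ⟨F, F₀, hF, -, rfl, hFt⟩ ⟨G, G₀, hG, hG₀, rfl, hGt⟩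
    rw [Submodule.span_le]
    rintro _ ⟨i, rfl⟩
    by_contra hi
    have hind : LinearIndependent 𝕜 (Fin.cons (F₀ i) G₀ : Fin (d + 1) → Fin m → 𝕜) :=
      linearIndependent_finCons.2 ⟨hG₀, hi⟩
    have ht : Filter.Tendsto (fun a => (Fin.cons (F a i) (G a) : Fin (d + 1) → Fin m → 𝕜)) l
        (nhds (Fin.cons (F₀ i) G₀)) := by
      rw [tendsto_pi_nhds]
      intro j
      refine Fin.cases ?_ (fun j => ?_) j
      · simpa using (tendsto_pi_nhds.1 hFt) i
      · simpa using (tendsto_pi_nhds.1 hGt) j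
    have hev := ht.eventually
      ((isOpen_setOfPred_linearIndependent (𝕜 := 𝕜) (E := Fin m → 𝕜)).mem_nhds hind)
    obtain ⟨a, ha, hFa, hGa⟩ := (hev.and (hF.and hG)).exists
    refine (linearIndependent_finCons.1 ha).2 ?_
    rw [hGa, ← hFa]
    exact Submodule.subset_span ⟨i, rfl⟩
  exact le_antisymm (key hp hq) (key hq hp)

lemma ENNReal.denseRange_coe_nnreal : DenseRange ((↑) : ℝ≥0 → ℝ≥0∞) := by
  intro x
  rcases eq_or_ne x ⊤ with rfl | hx
  · exact mem_closure_of_tendsto ENNReal.tendsto_nat_nhds_top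
      (Filter.Eventually.of_forall fun k => ⟨(k : ℝ≥0), by simp⟩)
  · exact subset_closure ⟨x.toNNReal, ENNReal.coe_toNNReal hx⟩

instance neBot_comap_coe_weight {ι : Type*} (w : ι → ℝ≥0∞) :
    (Filter.comap (fun (u : ι → ℝ≥0) i => (u i : ℝ≥0∞)) (nhds w)).NeBot := by
  refine Filter.comap_neBot fun s hs => ?_
  obtain ⟨_, h1, u, rfl⟩ := mem_closure_iff_nhds.1
    (DenseRange.piMap (fun _ : ι => ENNReal.denseRange_coe_nnreal) w) s hs
  exact ⟨u, h1⟩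

end Limits

section RealVectors

variable (𝕜 : Type*) [RCLike 𝕜] {n : ℕ}

lemma LinearIndependent.rclike_ofReal {ι κ : Type*} [Fintype ι] {v : ι → κ → ℝ}
    (hv : LinearIndependent ℝ v) : LinearIndependent 𝕜 fun i j => ((v i j : ℝ) : 𝕜) := by
  rw [Fintype.linearIndependent_iff] at hv ⊢
  intro g hg i
  have hre := hv (fun i => RCLike.re (g i)) (by
    funext j
    have := congrArg RCLike.re (congrFun hg j)
    simpa [Finset.sum_apply] using this) i
  have him := hv (fun i => RCLike.im (g i)) (by
    funext j
    have := congrArg RCLike.im (congrFun hg j)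
    simpa [Finset.sum_apply] using this) i
  exact RCLike.ext (by simpa using hre) (by simpa using him)

lemma embedV_ofReal (c : Fin (2 * n - 2) → ℝ) :
    embedV 𝕜 n (fun i => (c i : 𝕜)) = fun m => ((embedV ℝ n c m : ℝ) : 𝕜) := by
  funext m
  simp only [embedV, Matrix.vecMulLinear_apply, Matrix.vecMul, dotProduct, basisMatrix,
      Matrix.of_apply]
  push_cast
  refine Finset.sum_congr rfl fun i _ => ?_
  split_ifs <;> simp

lemma lambdaForm_ofReal (c c' : Fin (2 * n - 2) → ℝ) :
    lambdaForm 𝕜 n (fun i => (c i : 𝕜)) (fun i => (c' i : 𝕜)) = ((lambdaForm ℝ n c c' : ℝ) : 𝕜) := by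
  rw [lambdaForm_apply, lambdaForm_apply]
  push_cast
  refine Finset.sum_congr rfl fun i _ => Finset.sum_congr rfl fun j _ => ?_
  simp only [lambdaMatrix, Matrix.of_apply]
  split_ifs <;> simp

end RealVectors

namespace PlanarCircularGraph

variable {n : ℕ} (Γ : PlanarCircularGraph n)

lemma isResponseMatrix_responseMatrix (w : Γ.Edge → ℝ≥0) :
    Γ.IsResponseMatrix w (Γ.responseMatrix w) :=
  (Γ.existsUnique_isResponseMatrix w).choose_spec.1

lemma responseMatrix_isSymm (w : Γ.Edge → ℝ≥0) : (Γ.responseMatrix w).IsSymm := by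
  have key : ∀ U U' : Fin n → ℝ, U' ⬝ᵥ (Γ.responseMatrix w).mulVec U =
      U ⬝ᵥ (Γ.responseMatrix w).mulVec U' := by
    intro U U'
    obtain ⟨φ, hφ, hk⟩ := Γ.exists_harmonic w U
    obtain ⟨φ', hφ', hk'⟩ := Γ.exists_harmonic w U'
    have h1 := Γ.isResponseMatrix_responseMatrix w φ hk
    have h2 := Γ.isResponseMatrix_responseMatrix w φ' hk'
    simp only [hφ] at h1
    simp only [hφ'] at h2
    rw [h1, h2, dotProduct, dotProduct]
    have e1 := Γ.sum_eq_sum_bdry (g := fun v => φ' v * Γ.current w φ v)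
      fun v hv => by rw [hk v hv, mul_zero]
    have e2 := Γ.sum_eq_sum_bdry (g := fun v => φ v * Γ.current w φ' v)
      fun v hv => by rw [hk' v hv, mul_zero]
    simp only [hφ'] at e1
    simp only [hφ] at e2
    rw [← e1, ← e2, sum_mul_current, sum_mul_current]
    exact Finset.sum_congr rfl fun e _ => by ring
  ext i j
  have := key (Pi.single i 1) (Pi.single j 1)
  simpa using this

lemma responseMatrix_mulVec_one (w : Γ.Edge → ℝ≥0) :
    (Γ.responseMatrix w).mulVec (fun _ => 1) = 0 := by
  have h0 : ∀ v, Γ.current w (fun _ => 1) v = 0 := fun v => by simp [current]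
  rw [Γ.isResponseMatrix_responseMatrix w (fun _ => 1) fun v _ => h0 v]
  exact funext fun i => h0 _

variable {Γ}

lemma IsEquilibrium.responseMatrix_mulVec {w : Γ.Edge → ℝ≥0} {h : Fin n → ℝ} {φ : Γ.Vert → ℝ}
    {f : Γ.Edge → ℝ} (H : Γ.IsEquilibrium (fun e => (w e : ℝ≥0∞)) h φ f) :
    (Γ.responseMatrix w).mulVec (fun i => φ (Γ.bdry i)) = fun i => Γ.netFlow f (Γ.bdry i) := by
  have hf : Γ.netFlow f = Γ.current w φ :=
    Γ.netFlow_eq_current fun e => by simpa using H.ohm e ENNReal.coe_ne_top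
  rw [hf]
  exact Γ.isResponseMatrix_responseMatrix w φ fun v hv => by rw [← hf]; exact H.kirchhoff v hv

variable [NeZero n]

/-- The vector of `V` that belongs to the boundary data of a potential and a flow. -/
noncomputable def stateVector (Γ : PlanarCircularGraph n) (φ : Γ.Vert → ℝ) (f : Γ.Edge → ℝ) :
    Fin (2 * n - 2) → ℝ :=
  boundaryVector (fun i => φ (Γ.bdry i), fun i => Γ.netFlow f (Γ.bdry i))

lemma IsEquilibrium.lambdaForm_stateVector {w : Γ.Edge → ℝ≥0∞} {h h' : Fin n → ℝ}
    {φ φ' : Γ.Vert → ℝ} {f f' : Γ.Edge → ℝ} (H : Γ.IsEquilibrium w h φ f)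
    (H' : Γ.IsEquilibrium w h' φ' f') :
    lambdaForm ℝ n (Γ.stateVector φ f) (Γ.stateVector φ' f') = 0 := by
  rw [stateVector, stateVector, lambdaForm_boundaryVector H.sum_netFlow H'.sum_netFlow,
    H.reciprocity H', sub_self]

/-- The sources at all boundary vertices but the last one. -/
def unitSource (n : ℕ) (j : Fin (n - 1)) : Fin n → ℝ :=
  Pi.single (Fin.castLE (Nat.sub_le n 1) j) 1

/-- A combination of the states that gives the zero vector has no currents and constant
potential, so that its source is constant; but the source vanishes at the last vertex. -/
lemma linearIndependent_stateVector {w : Γ.Edge → ℝ≥0∞} {φ : Fin (n - 1) → Γ.Vert → ℝ}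
    {f : Fin (n - 1) → Γ.Edge → ℝ} (H : ∀ j, Γ.IsEquilibrium w (unitSource n j) (φ j) (f j)) :
    LinearIndependent ℝ fun j => Γ.stateVector (φ j) (f j) := by
  rw [Fintype.linearIndependent_iff]
  intro g hg
  let U : Fin n → ℝ := ∑ j, g j • fun i => φ j (Γ.bdry i)
  let I : Fin n → ℝ := ∑ j, g j • fun i => Γ.netFlow (f j) (Γ.bdry i)
  have hUI : boundaryVector (U, I) = 0 := by
    rw [← hg]
    simp only [stateVector, ← map_smul, ← map_sum]
    congr 1
    ext i
    · simp [U, Prod.fst_sum]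
    · simp [I, Prod.snd_sum]
  have hI : ∑ i, I i = 0 := by
    simp only [I, Finset.sum_apply, Pi.smul_apply, smul_eq_mul]
    rw [Finset.sum_comm]
    simp only [← Finset.mul_sum, (H _).sum_netFlow, mul_zero, Finset.sum_const_zero]
  obtain ⟨hI0, hU⟩ := eq_of_boundaryVector_eq_zero hI hUI
  have hsum : ∀ i, U i = ∑ j, g j * unitSource n j i := fun i => by
    have : U i + I i = ∑ j, g j * unitSource n j i := by
      simp only [U, I, Finset.sum_apply, Pi.smul_apply, smul_eq_mul, ← Finset.sum_add_distrib,
        ← mul_add, (H _).boundary]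
    simpa [hI0] using this
  have hn := NeZero.pos n
  have hlast : U ⟨n - 1, by omega⟩ = 0 := by
    rw [hsum]
    refine Finset.sum_eq_zero fun j _ => ?_
    rw [unitSource, Pi.single_eq_of_ne, mul_zero]
    intro h
    have := congrArg Fin.val h
    simp at this
    omega
  intro j
  have hj := hsum (Fin.castLE (Nat.sub_le n 1) j)
  rw [hU, ← hU ⟨n - 1, by omega⟩, hlast, Finset.sum_eq_single j] at hj
  · simpa [unitSource] using hj.symm
  · intro b _ hb
    rw [unitSource, Pi.single_eq_of_ne, mul_zero]
    exact fun h => hb ((Fin.castLE_injective _) h).symm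
  · simp

variable (𝕜 : Type*) [RCLike 𝕜]

/-- The rows of `Ω_n` satisfy a linear relation, because constant potentials produce no
currents. -/
lemma finrank_rowSpace_le (Γ : PlanarCircularGraph n) (w : Γ.Edge → ℝ≥0) :
    Module.finrank 𝕜 (Γ.rowSpace 𝕜 w) ≤ n - 1 := by
  by_contra hlt
  have hli : LinearIndependent 𝕜 fun (i : Fin n) c =>
      ((omegaMatrix (Γ.responseMatrix w) i c : ℝ) : 𝕜) := by
    rw [linearIndependent_iff_card_le_finrank_span, Fintype.card_fin]
    change n ≤ Module.finrank 𝕜 (Γ.rowSpace 𝕜 w)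
    omega
  have hrel := sum_smul_omegaMatrix (Γ.responseMatrix_isSymm w) (fun _ => 1)
    (by simp [responseMatrix_mulVec_one])
  have hzero : boundaryVector ((fun _ => 1 : Fin n → ℝ), 0) = 0 := by
    funext m
    simp [boundaryVector_apply, boundaryCoord]
  rw [responseMatrix_mulVec_one, hzero, map_zero] at hrel
  have := Fintype.linearIndependent_iff.1 hli
    (fun i => (((-1) ^ ((i : ℕ) + 1) * 1 : ℝ) : 𝕜)) (by
      funext m
      have := congrArg (fun x : ℝ => (x : 𝕜)) (congrFun hrel m)
      simpa [Finset.sum_apply] using this) 0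
  simp at this

lemma IsEquilibrium.stateVector_mem_rowSpace {w : Γ.Edge → ℝ≥0} {h : Fin n → ℝ} {φ : Γ.Vert → ℝ}
    {f : Γ.Edge → ℝ} (H : Γ.IsEquilibrium (fun e => (w e : ℝ≥0∞)) h φ f) :
    embedV 𝕜 n (fun m => ((Γ.stateVector φ f m : ℝ) : 𝕜)) ∈ Γ.rowSpace 𝕜 w := by
  have hrel := sum_smul_omegaMatrix (Γ.responseMatrix_isSymm w) (fun i => φ (Γ.bdry i))
    (by rw [H.responseMatrix_mulVec]; exact H.sum_netFlow)
  rw [H.responseMatrix_mulVec] at hrel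
  rw [embedV_ofReal, stateVector, ← hrel]
  have : (fun m => (((∑ i : Fin n, ((-1) ^ ((i : ℕ) + 1) * φ (Γ.bdry i)) •
      omegaMatrix (Γ.responseMatrix w) i) m : ℝ) : 𝕜)) =
      ∑ i : Fin n, (((-1) ^ ((i : ℕ) + 1) * φ (Γ.bdry i) : ℝ) : 𝕜) •
        fun c => ((omegaMatrix (Γ.responseMatrix w) i c : ℝ) : 𝕜) := by
    funext m
    simp [Finset.sum_apply]
  rw [this]
  exact Submodule.sum_mem _ fun i _ => Submodule.smul_mem _ _ (Submodule.subset_span ⟨i, rfl⟩)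

lemma linearIndependent_stateVector_ofReal {w : Γ.Edge → ℝ≥0∞} {φ : Fin (n - 1) → Γ.Vert → ℝ}
    {f : Fin (n - 1) → Γ.Edge → ℝ} (H : ∀ j, Γ.IsEquilibrium w (unitSource n j) (φ j) (f j)) :
    LinearIndependent 𝕜 fun j m => ((Γ.stateVector (φ j) (f j) m : ℝ) : 𝕜) :=
  (linearIndependent_stateVector H).rclike_ofReal 𝕜

lemma span_stateVector_eq_rowSpace {w : Γ.Edge → ℝ≥0} {φ : Fin (n - 1) → Γ.Vert → ℝ}
    {f : Fin (n - 1) → Γ.Edge → ℝ}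
    (H : ∀ j, Γ.IsEquilibrium (fun e => (w e : ℝ≥0∞)) (unitSource n j) (φ j) (f j)) :
    Submodule.span 𝕜 (Set.range fun j =>
      embedV 𝕜 n (fun m => ((Γ.stateVector (φ j) (f j) m : ℝ) : 𝕜))) = Γ.rowSpace 𝕜 w := by
  refine Submodule.eq_of_le_of_finrank_le ?_ ?_
  · rw [Submodule.span_le]
    rintro _ ⟨j, rfl⟩
    exact (H j).stateVector_mem_rowSpace 𝕜
  · have hli : LinearIndependent 𝕜 fun j =>
        embedV 𝕜 n (fun m => ((Γ.stateVector (φ j) (f j) m : ℝ) : 𝕜)) :=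
      (linearIndependent_stateVector_ofReal 𝕜 H).map' _
        (LinearMap.ker_eq_bot.2 (embedV_injective 𝕜))
    rw [finrank_span_eq_card hli, Fintype.card_fin]
    exact Γ.finrank_rowSpace_le 𝕜 w

end PlanarCircularGraph

namespace CactusNetwork

variable {n : ℕ} [NeZero n] (𝕜 : Type*) [RCLike 𝕜]

open PlanarCircularGraph

/-- The point of a network is spanned by the vectors of its equilibria for the unit sources, which
are limits of the corresponding vectors of the networks with finite conductivities. -/
lemma isImage_span_stateVector (e : CactusNetwork n) {φ : Fin (n - 1) → e.Vert → ℝ}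
    {f : Fin (n - 1) → e.Edge → ℝ}
    (H : ∀ j, e.IsEquilibrium e.weight (unitSource n j) (φ j) (f j)) :
    e.IsImage 𝕜 (Submodule.span 𝕜 (Set.range fun j =>
      embedV 𝕜 n (fun m => ((e.stateVector (φ j) (f j) m : ℝ) : 𝕜)))) := by
  choose φ' f' H' using fun (u : e.Edge → ℝ≥0) (j : Fin (n - 1)) =>
    e.exists_isEquilibrium (fun i => (u i : ℝ≥0∞)) (unitSource n j)
  refine ⟨fun u j => embedV 𝕜 n (fun m => ((e.stateVector (φ' u j) (f' u j) m : ℝ) : 𝕜)),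
    fun j => embedV 𝕜 n (fun m => ((e.stateVector (φ j) (f j) m : ℝ) : 𝕜)),
    Filter.Eventually.of_forall fun u => span_stateVector_eq_rowSpace 𝕜 (H' u),
    (linearIndependent_stateVector_ofReal 𝕜 H).map' _
      (LinearMap.ker_eq_bot.2 (embedV_injective 𝕜)), rfl, ?_⟩
  rw [tendsto_pi_nhds]
  intro j
  have hU := fun i => (H j).tendsto_bdry (fun u => H' u j) i
  have hI : ∀ i, Filter.Tendsto (fun u => e.netFlow (f' u j) (e.bdry i))
      (Filter.comap (fun u i => (u i : ℝ≥0∞)) (nhds e.weight))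
      (nhds (e.netFlow (f j) (e.bdry i))) := by
    intro i
    have e1 : e.netFlow (f j) (e.bdry i) = unitSource n j i - φ j (e.bdry i) := by
      linarith [(H j).boundary i]
    have e2 : ∀ u, e.netFlow (f' u j) (e.bdry i) = unitSource n j i - φ' u j (e.bdry i) :=
      fun u => by linarith [(H' u j).boundary i]
    simp only [e1, e2]
    exact (hU i).const_sub _
  have hs : Filter.Tendsto (fun u => e.stateVector (φ' u j) (f' u j))
      (Filter.comap (fun u i => (u i : ℝ≥0∞)) (nhds e.weight))
      (nhds (e.stateVector (φ j) (f j))) :=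
    ((LinearMap.continuous_of_finiteDimensional boundaryVector).tendsto _).comp
      ((tendsto_pi_nhds.2 hU).prodMk_nhds (tendsto_pi_nhds.2 hI))
  have hc : Continuous fun (c : Fin (2 * n - 2) → ℝ) => embedV 𝕜 n (fun m => (c m : 𝕜)) :=
    (LinearMap.continuous_of_finiteDimensional (embedV 𝕜 n)).comp
      (continuous_pi fun m => RCLike.continuous_ofReal.comp (continuous_apply m))
  exact (hc.tendsto _).comp hs

lemma exists_isImage_iff (e : CactusNetwork n) :
    ∃ p, (∀ q, e.IsImage 𝕜 q ↔ q = p) ∧ pluckerLine (n - 1) p ∈ projectiveOrbit 𝕜 n := by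
  choose φ f H using fun j : Fin (n - 1) => e.exists_isEquilibrium e.weight (unitSource n j)
  have him := e.isImage_span_stateVector 𝕜 H
  refine ⟨_, fun q => ⟨fun hq => GrassmannianTendsto.unique hq him, fun hq => hq ▸ him⟩,
    pluckerLine_mem_projectiveOrbit 𝕜 (linearIndependent_stateVector_ofReal 𝕜 H) fun i j => ?_⟩
  rw [lambdaForm_ofReal, (H i).lambdaForm_stateVector (H j), RCLike.ofReal_zero]

end CactusNetwork

section EmptyNetwork

variable (𝕜 : Type*) [RCLike 𝕜] {n : ℕ}

lemma responseMatrix_emptyPlanarCircularGraph (w : (emptyPlanarCircularGraph n).Edge → ℝ≥0) :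
    (emptyPlanarCircularGraph n).responseMatrix w = 0 := by
  refine (PlanarCircularGraph.existsUnique_isResponseMatrix _ w).unique
    (PlanarCircularGraph.isResponseMatrix_responseMatrix _ w) fun φ _ => ?_
  have h0 : ∀ v, (emptyPlanarCircularGraph n).current w φ v = 0 := fun v => by
    have : IsEmpty (emptyPlanarCircularGraph n).Edge := inferInstanceAs (IsEmpty Empty)
    rw [PlanarCircularGraph.current]
    exact Finset.sum_eq_zero fun e _ => isEmptyElim e
  rw [Matrix.zero_mulVec]
  exact funext fun i => (h0 _).symm

/-- All rows of `Ω_n` but the first are the vectors `w_2, w_4, …` if there are no currents. -/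
lemma omegaMatrix_zero_succ (i : Fin (n - 1)) :
    (fun c => ((omegaMatrix (0 : Matrix (Fin n) (Fin n) ℝ) ⟨i + 1, by omega⟩ c : ℝ) : 𝕜)) =
      embedV 𝕜 n (Pi.single (⟨2 * (i : ℕ) + 1, by omega⟩ : Fin (2 * n - 2)) 1) := by
  funext c
  simp only [embedV, Matrix.vecMulLinear_apply, Matrix.single_one_vecMul, basisMatrix,
    Matrix.row_apply, Matrix.of_apply, omegaMatrix, Matrix.zero_apply, mul_zero,
    Nat.succ_ne_zero, false_and, if_false]
  split_ifs <;> first | omega | simp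

variable [NeZero n]

lemma rowSpace_emptyPlanarCircularGraph (w : (emptyPlanarCircularGraph n).Edge → ℝ≥0) :
    Submodule.span 𝕜 (Set.range fun i : Fin (n - 1) =>
      embedV 𝕜 n (Pi.single (⟨2 * (i : ℕ) + 1, by omega⟩ : Fin (2 * n - 2)) 1)) =
      (emptyPlanarCircularGraph n).rowSpace 𝕜 w := by
  refine Submodule.eq_of_le_of_finrank_le ?_ ?_
  · rw [Submodule.span_le]
    rintro _ ⟨i, rfl⟩
    refine Submodule.subset_span ⟨⟨i + 1, by omega⟩, ?_⟩
    rw [responseMatrix_emptyPlanarCircularGraph]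
    exact omegaMatrix_zero_succ 𝕜 i
  · have hli := (linearIndependent_vacuum (n := n) 𝕜).map' (embedV 𝕜 n)
      (LinearMap.ker_eq_bot.2 (embedV_injective 𝕜))
    have hf := finrank_span_eq_card hli
    rw [Fintype.card_fin] at hf
    exact (PlanarCircularGraph.finrank_rowSpace_le 𝕜 _ w).trans hf.ge

lemma isImage_emptyNetwork : (emptyNetwork n).IsImage 𝕜 (Submodule.span 𝕜
    (Set.range fun i : Fin (n - 1) =>
      embedV 𝕜 n (Pi.single (⟨2 * (i : ℕ) + 1, by omega⟩ : Fin (2 * n - 2)) 1))) :=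
  ⟨fun _ i => embedV 𝕜 n (Pi.single (⟨2 * (i : ℕ) + 1, by omega⟩ : Fin (2 * n - 2)) 1), _,
    Filter.Eventually.of_forall fun w => rowSpace_emptyPlanarCircularGraph 𝕜 w,
    (linearIndependent_vacuum (n := n) 𝕜).map' (embedV 𝕜 n)
      (LinearMap.ker_eq_bot.2 (embedV_injective 𝕜)), rfl, tendsto_const_nhds⟩

end EmptyNetwork

lemma exists_isFundamentalRep_vacuum (𝕜 : Type*) [RCLike 𝕜] (n : ℕ) (l : Fin (n - 1))
    (hl : ∀ i, i ≤ l) :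
    ∃ (F : Subrepresentation (exteriorRep (lambdaForm 𝕜 n) (n - 1)))
      (hF : vacuumVector 𝕜 n ∈ F.toSubmodule),
      IsFundamentalRep (ω := lambdaForm 𝕜 n) (M := F.toSubmodule) F.toRepresentation l
        ⟨vacuumVector 𝕜 n, hF⟩ := by
  have hk : Module.finrank 𝕜 (Fin (2 * n - 2) → 𝕜) = (n - 1) + (n - 1) := by simp; omega
  obtain ⟨b, hb, hb'⟩ := exists_isSymplecticBasis (lambdaForm_skew 𝕜 n)
    (lambdaForm_nondegenerate 𝕜 n) hk _ (linearIndependent_vacuum 𝕜) (lambdaForm_vacuum 𝕜)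
  have hv : vacuumVector 𝕜 n = exteriorPower.ιMulti 𝕜 (n - 1) fun i => b (.inl i) := by
    simp only [hb', vacuumVector]
  simp only [hv]
  exact ⟨_, mem_orbitSpan _ _ _, hb.isFundamentalRep_orbitSpan l hl⟩

theorem mainTheorem6 (𝕜 : Type*) [RCLike 𝕜] (n : ℕ) (hn : 2 ≤ n) :
    -- the last fundamental representation and its highest weight vector
    (∃ (F : Subrepresentation (exteriorRep (lambdaForm 𝕜 n) (n - 1)))
      (hF : vacuumVector 𝕜 n ∈ F.toSubmodule),
      IsFundamentalRep (ω := lambdaForm 𝕜 n) (M := F.toSubmodule) F.toRepresentation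
        (⟨n - 2, by omega⟩ : Fin (n - 1))
        ⟨vacuumVector 𝕜 n, hF⟩) ∧
    -- the highest weight vector represents the point of the empty network
    (∃ p, (emptyNetwork n).IsImage 𝕜 p ∧ pluckerLine (n - 1) p =
      Submodule.span 𝕜 {exteriorPower.map (n - 1) (embedV 𝕜 n) (vacuumVector 𝕜 n)}) ∧
    -- every network has a well-defined point, which lies in the projectivised orbit
    (∀ e : CactusNetwork n, ∃ p, (∀ q, e.IsImage 𝕜 q ↔ q = p) ∧
      pluckerLine (n - 1) p ∈ projectiveOrbit 𝕜 n) := by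
  have : NeZero n := ⟨by omega⟩
  refine ⟨exists_isFundamentalRep_vacuum 𝕜 n _ fun i => ?_, ⟨_, isImage_emptyNetwork 𝕜, ?_⟩,
    fun e => e.exists_isImage_iff 𝕜⟩
  · change (i : ℕ) ≤ n - 2
    omega
  · rw [pluckerLine_span, vacuumVector, exteriorPower.map_apply_ιMulti]
    rfl
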